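/- Let $(X,d)$ be a complete separable metric space and let $E:X\to\mathbb{R}\cup\{+\infty\}$ be lower semicontinuous, with dense domain $D(E)=\{E<\infty\}$ and bounded from below on every bounded set. Assume that there is $\lambda\in\mathbb{R}$ such that from every $x\in X$ there starts an $\mathrm{EVI}_\lambda$-gradient flow of $E$, i.e. a curve $(\gamma_t)_{t>0}$, locally absolutely continuous on $(0,\infty)$, with $\gamma_t\to x$ as $t\downarrow 0$ and, for every $y\in X$, $$\tfrac12\tfrac{d}{dt}d^2(\gamma_t,y)+\tfrac{\lambda}{2}d^2(\gamma_t,y)+E(\gamma_t)\le E(y)\qquad\text{for a.e. } t>0 .$$ Let $|\partial E|$ be the slope of $E$: $|\partial E|(x)=+\infty$ if $x\notin D(E)$, $|\partial E|(x)=0$ if $x\in D(E)$ is isolated, and $|\partial E|(x)=\limsup_{y\to x}[E(x)-E(y)]^+/d(x,y)$ otherwise. Assume that there is a Hausdorff topology $\sigma$ on $X$ such that every $d$-bounded sequence has a $\sigma$-convergent subsequence, and such that $d$ (as a function on $X\times X$) and $|\partial E|$ are $\sigma$-sequentially lower semicontinuous. For $\gamma\in C([0,1],X)$ put $\mathcal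 A(\gamma)=\frac12\int_0^1|\dot\gamma_t|^2\,dt$, where $|\dot\gamma_t|$ is the metric speed and $\mathcal A(\gamma)=+\infty$ if $\gamma$ is not absolutely continuous, and $\mathcal I(\gamma)=\frac12\int_0^1|\partial E|^2(\gamma_t)\,dt$. For $\varepsilon\ge 0$ let $\mathcal A_\varepsilon=\mathcal A+\varepsilon^2\mathcal I$ (with $0\cdot\infty=0$), let $C_\varepsilon(x,y)$ be the infimum of $\mathcal A_\varepsilon(\gamma)$ over all $\gamma\in C([0,1],X)$ with $\gamma_0=x$, $\gamma_1=y$, and let $\Lambda_\varepsilon(x,y)$ be the set of $\omega\in AC^2([0,1],X)$ with $\omega_0=x$, $\omega_1=y$ and $\mathcal A_\varepsilon(\omega)=C_\varepsilon(x,y)$. Fix $x,y\in X$ such that for some $\varepsilon>0$ the infimum $C_\varepsilon(x,y)$ is finite and attained. Then $C_\varepsilon(x,y)<\infty$ for every $\varepsilon\ge0$, and the map $\varepsilon\mapsto C_\varepsilon(x,y)$ is locally absolutely continuous on $[0,\infty)$ and left and right differentiable at every point of $(0,\infty)$. For every $\varepsilon>0$ the functional $\mathcal I$ attains a (finite) maximum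 and minimum on $\Lambda_\varepsilon(x,y)$, and $$\frac{d^-}{d\varepsilon}C_\varepsilon(x,y)=2\varepsilon\max_{\Lambda_\varepsilon(x,y)}\mathcal I,\qquad \frac{d^+}{d\varepsilon}C_\varepsilon(x,y)=2\varepsilon\min_{\Lambda_\varepsilon(x,y)}\mathcal I .$$ On $(0,\infty)$ the left derivative is left-continuous and the right derivative is right-continuous. -/

import Mathlib

open Set Filter Topology MeasureTheory
open scoped ENNReal

namespace EntropicCost

section Curves

variable {X : Type*} [MetricSpace X]

/-- Absolute continuity of a curve on the compact interval `[a, b]`: there is `m ∈ L¹(a, b)` with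
`d(γ_s, γ_t) ≤ ∫_s^t m(r) dr` for all `a ≤ s ≤ t ≤ b`.  Curves are functions on `ℝ`; only their
values on the interval in question matter. -/
def IsACOn (γ : ℝ → X) (a b : ℝ) : Prop :=
  ∃ m : ℝ → ℝ, IntegrableOn m (Icc a b) ∧
    ∀ s t : ℝ, a ≤ s → s ≤ t → t ≤ b → dist (γ s) (γ t) ≤ ∫ r in s..t, m r

/-- Metric speed `|γ̇_t|`, the limit of `d(γ_s, γ_t) / |s - t|` as `s → t`.  It is written as an
upper limit to be defined everywhere; the limit exists at almost every `t` for absolutely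
continuous curves. -/
noncomputable def metricSpeed (γ : ℝ → X) (t : ℝ) : ℝ≥0∞ :=
  limsup (fun s : ℝ => edist (γ s) (γ t) / edist s t) (𝓝[≠] t)

/-- `γ ∈ AC²([0,1], X)`: absolutely continuous on `[0,1]` with square integrable metric speed. -/
def IsAC2 (γ : ℝ → X) : Prop :=
  IsACOn γ 0 1 ∧ ∫⁻ t in Ioo (0 : ℝ) 1, metricSpeed γ t ^ 2 < ⊤

/-- `γ : x ⇝ y`, i.e. `γ ∈ C([0,1], X)` with `γ_0 = x` and `γ_1 = y`. -/
def Joins (γ : ℝ → X) (x y : X) : Prop :=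
  ContinuousOn γ (Icc 0 1) ∧ γ 0 = x ∧ γ 1 = y

/-- Descending slope `|∂E|` of a functional `E : X → ℝ ∪ {+∞}`: it is `+∞` outside the domain
`{E < +∞}`, and `limsup_{y → x} [E x - E y]⁺ / d(x, y)` (which is `0` at isolated points, where the
punctured neighbourhood filter is trivial) on the domain. -/
noncomputable def slope (E : X → EReal) (x : X) : ℝ≥0∞ :=
  open Classical in
  if E x = ⊤ then ⊤
  else limsup (fun y : X => (E x - E y).toENNReal / edist x y) (𝓝[≠] x)

/-- `γ : (0, ∞) → X` is a gradient flow of `E` in the `EVI_lam` sense starting from `x`. -/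
structure IsEVIFlow (E : X → EReal) (lam : ℝ) (x : X) (γ : ℝ → X) : Prop where
  ac_loc : ∀ a b : ℝ, 0 < a → a ≤ b → IsACOn γ a b
  evi : ∀ y : X, ∀ᵐ t ∂(volume.restrict (Ioi (0 : ℝ))),
    (((1 / 2) * deriv (fun s : ℝ => dist (γ s) y ^ 2) t
        + (lam / 2) * dist (γ t) y ^ 2 : ℝ) : EReal) + E (γ t) ≤ E y
  start_mem : x ∈ closure {z : X | E z < ⊤}
  start : Tendsto γ (𝓝[>] 0) (𝓝 x)

/-- Standing hypotheses on the functional `E : X → ℝ ∪ {+∞}` (the value `-∞` of `EReal` is excluded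
by `bddBelow`). -/
structure IsAdmissibleEnergy (E : X → EReal) : Prop where
  lsc : LowerSemicontinuous E
  dense_domain : Dense {z : X | E z < ⊤}
  bddBelow : ∀ B : Set X, Bornology.IsBounded B → ∃ c : ℝ, ∀ z ∈ B, (c : EReal) ≤ E z
  flow : ∃ lam : ℝ, ∀ x : X, ∃ γ : ℝ → X, IsEVIFlow E lam x γ

/-- There is a Hausdorff topology `σ` on `X` for which `d`-bounded sets are relatively sequentially
compact, and for which the distance (jointly) and the slope are sequentially lower
semicontinuous. -/
def HasWeakTopology (E : X → EReal) : Prop :=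
  ∃ σ : TopologicalSpace X, @T2Space X σ ∧
    (∀ u : ℕ → X, Bornology.IsBounded (range u) →
      ∃ z : X, ∃ φ : ℕ → ℕ, StrictMono φ ∧ Tendsto (u ∘ φ) atTop (@nhds X σ z)) ∧
    (∀ (u v : ℕ → X) (z w : X), Tendsto u atTop (@nhds X σ z) → Tendsto v atTop (@nhds X σ w) →
      edist z w ≤ liminf (fun n => edist (u n) (v n)) atTop) ∧
    (∀ (u : ℕ → X) (z : X), Tendsto u atTop (@nhds X σ z) →
      slope E z ≤ liminf (fun n => slope E (u n)) atTop)

/-- Kinetic energy `𝒜(γ) = ½ ∫₀¹ |γ̇_t|² dt`, equal to `+∞` if `γ` is not absolutely continuous. -/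
noncomputable def kinetic (γ : ℝ → X) : ℝ≥0∞ :=
  open Classical in
  if IsACOn γ 0 1 then 2⁻¹ * ∫⁻ t in Ioo (0 : ℝ) 1, metricSpeed γ t ^ 2 else ⊤

/-- Halved Fisher information `ℐ(γ) = ½ ∫₀¹ |∂E|²(γ_t) dt`. -/
noncomputable def fisher (E : X → EReal) (γ : ℝ → X) : ℝ≥0∞ :=
  2⁻¹ * ∫⁻ t in Ioo (0 : ℝ) 1, slope E (γ t) ^ 2

/-- `𝒜_ε(γ) = 𝒜(γ) + ε² ℐ(γ)`, with `0 · ∞ = 0`. -/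
noncomputable def action (E : X → EReal) (ε : ℝ) (γ : ℝ → X) : ℝ≥0∞ :=
  kinetic γ + ENNReal.ofReal (ε ^ 2) * fisher E γ

/-- The entropic cost `C_ε(x, y)`, the infimum of `𝒜_ε` over all continuous curves `x ⇝ y`. -/
noncomputable def cost (E : X → EReal) (x y : X) (ε : ℝ) : ℝ≥0∞ :=
  ⨅ (γ : ℝ → X) (_ : Joins γ x y), action E ε γ

/-- The `ε`-Schrödinger problem between `x` and `y` is solvable: its infimum is finite and
attained. -/
def IsSolvable (E : X → EReal) (x y : X) (ε : ℝ) : Prop :=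
  ∃ γ : ℝ → X, Joins γ x y ∧ action E ε γ = cost E x y ε ∧ cost E x y ε < ⊤

/-- The set `Λ_ε(x, y)` of `ε`-minimizers. -/
def minimizers (E : X → EReal) (x y : X) (ε : ℝ) : Set (ℝ → X) :=
  {ω | IsAC2 ω ∧ ω 0 = x ∧ ω 1 = y ∧ action E ε ω = cost E x y ε}

end Curves

end EntropicCost

/-! For a fixed curve, `action` is affine in `s = ε²`, with value `𝒜` at `s = 0` and slope `ℐ`. So
the cost, as a function of `s > 0`, is the lower envelope of the lines `p.1 + s * p.2`, where `p`
runs over the pairs (kinetic energy, Fisher information) of curves for which both are finite. For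
such an envelope the one-sided derivatives are the extreme slopes of the optimal lines, provided the
optimal pairs form a nonempty compact set depending upper hemicontinuously on `s`; `slope_mem` then
squeezes the difference quotients. The chain rule for `ε ↦ ε²` supplies the factor `2ε`, and
one-sided continuity is again hemicontinuity.

What the envelope needs is a single compactness statement, `exists_joins_le_of_tendsto`: a sequence
of curves whose two functionals converge has a weak limit curve on which neither exceeds its limit.
To make kinetic energy pass to weak limits, it is encoded in `HasEnergyBound`, a family of
inequalities each involving only two times; these survive lower semicontinuity of `d`. Fisher
information is handled by Fatou.

Near `ε = 0` this is not enough, since curves of infinite Fisher information compete at `ε = 0`.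
Continuity there uses the gradient flow. A curve with finite action has endpoints in the domain of
`E` (`lt_top_and_lt_top_of_fisher`). A competitor for `𝒜` alone can then be pushed along the flow
for a short time `τ` and reconnected to `x` and `y` by flow trajectories: exponential contraction
keeps the middle cheap, the energy dissipated at the ends tends to zero with `τ`, and the flow makes
the slope square integrable (`exists_joins_fisher_lt_top`). Contraction, dissipation and slope
bounds are all drawn from the integrated inequality in `IsDescentCurve`. A continuous function with
nonnegative right derivative is the integral of that derivative, which gives absolute continuity up
to `0`. -/

namespace EntropicCost

/-! ### Two-point energy bounds versus absolute continuity and metric speed. -/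

section EnergyBounds

variable {X : Type*} [MetricSpace X]

/-- `γ` has energy at most `e t - e s` on every subinterval `[s, t]` of `[a, b]`, in the discrete
sense `d(γ_s, γ_t)² ≤ (t - s) (e t - e s)`. -/
def HasEnergyBound (γ : ℝ → X) (e : ℝ → ℝ) (a b : ℝ) : Prop :=
  ∀ s t : ℝ, a ≤ s → s ≤ t → t ≤ b → dist (γ s) (γ t) ^ 2 ≤ (t - s) * (e t - e s)

theorem HasEnergyBound.monotoneOn {γ : ℝ → X} {e : ℝ → ℝ} {a b : ℝ}
    (h : HasEnergyBound γ e a b) : MonotoneOn e (Icc a b) := by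
  intro s hs t ht hst
  rcases hst.eq_or_lt with rfl | hst'
  · exact le_rfl
  · have h1 := (sq_nonneg _).trans (h s t hs.1 hst ht.2)
    have h2 := nonneg_of_mul_nonneg_right h1 (sub_pos.2 hst')
    linarith

theorem HasEnergyBound.dist_le_sqrt {γ : ℝ → X} {e : ℝ → ℝ} {a b : ℝ}
    (h : HasEnergyBound γ e a b) {s t : ℝ} (hs : a ≤ s) (hst : s ≤ t) (ht : t ≤ b) :
    dist (γ s) (γ t) ≤ √(t - s) * √(e t - e s) := by
  rw [← Real.sqrt_mul (sub_nonneg.2 hst)]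
  exact Real.le_sqrt_of_sq_le (h s t hs hst ht)

/-- Concatenation of two energy bounds. -/
theorem HasEnergyBound.union {γ : ℝ → X} {e : ℝ → ℝ} {a b c : ℝ}
    (h₁ : HasEnergyBound γ e a b) (h₂ : HasEnergyBound γ e b c) : HasEnergyBound γ e a c := by
  intro s t hs hst ht
  rcases le_total t b with htb | htb
  · exact h₁ s t hs hst htb
  rcases le_total b s with hbs | hbs
  · exact h₂ s t hbs hst ht
  have k₁ := h₁ s b hs hbs le_rfl
  have k₂ := h₂ b t le_rfl htb ht
  have m₁ : e s ≤ e b := h₁.monotoneOn ⟨hs, hbs⟩ ⟨hs.trans hbs, le_rfl⟩ hbs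
  have m₂ : e b ≤ e t := h₂.monotoneOn ⟨le_rfl, htb.trans ht⟩ ⟨htb, ht⟩ htb
  have hd := dist_triangle (γ s) (γ b) (γ t)
  set p := dist (γ s) (γ b)
  set q := dist (γ b) (γ t)
  have hp : 0 ≤ p := dist_nonneg
  have hq : 0 ≤ q := dist_nonneg
  -- The cross term of `(p + q)²`: `p² q²` is at most the product of the two summands on the right,
  -- so AM-GM applies.
  have hpq : 2 * (p * q) ≤ (b - s) * (e t - e b) + (t - b) * (e b - e s) := by
    have h1 : (p * q) ^ 2 ≤ ((b - s) * (e t - e b)) * ((t - b) * (e b - e s)) := by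
      calc (p * q) ^ 2 = p ^ 2 * q ^ 2 := by ring
        _ ≤ ((b - s) * (e b - e s)) * ((t - b) * (e t - e b)) := by gcongr
        _ = _ := by ring
    have n₁ : 0 ≤ (b - s) * (e t - e b) := mul_nonneg (by linarith) (by linarith)
    have n₂ : 0 ≤ (t - b) * (e b - e s) := mul_nonneg (by linarith) (by linarith)
    refine abs_le_of_sq_le_sq' ?_ (by linarith) |>.2
    nlinarith [sq_nonneg ((b - s) * (e t - e b) - (t - b) * (e b - e s))]
  calc dist (γ s) (γ t) ^ 2 ≤ (p + q) ^ 2 := by gcongr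
    _ ≤ _ := by nlinarith

/-- The increments of a monotone function over disjoint intervals add up to at most its total
increment. -/
theorem sum_sub_le_of_pairwiseDisjoint {ι : Type*} {e : ℝ → ℝ} {a b : ℝ} (hab : a ≤ b)
    (he : MonotoneOn e (Icc a b)) (s : Finset ι) (p q : ι → ℝ)
    (hpq : ∀ i ∈ s, a ≤ p i ∧ p i ≤ q i ∧ q i ≤ b)
    (hd : (s : Set ι).PairwiseDisjoint fun i => Ioc (p i) (q i)) :
    ∑ i ∈ s, (e (q i) - e (p i)) ≤ e b - e a := by
  classical
  -- A degenerate interval has empty `Ioc` and could lie inside another one, which would spoil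
  -- peeling off the rightmost interval; it contributes zero to the sum.
  wlog hlt : ∀ i ∈ s, p i < q i generalizing s
  · rw [← Finset.sum_filter_of_ne (p := fun i => p i < q i)]
    · refine this _ (fun i hi => hpq i (Finset.mem_filter.1 hi).1) (hd.subset ?_)
        (fun i hi => (Finset.mem_filter.1 hi).2)
      exact_mod_cast Finset.filter_subset _ _
    · intro i hi hne
      refine (hpq i hi).2.1.lt_of_ne fun h => hne (by rw [h, sub_self])
  induction hn : s.card generalizing s b with
  | zero =>
    rw [Finset.card_eq_zero] at hn
    subst hn
    simpa using he ⟨le_rfl, hab⟩ ⟨hab, le_rfl⟩ hab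
  | succ n ih =>
    have hne : s.Nonempty := by rw [← Finset.card_pos]; omega
    obtain ⟨i, hi, hmax⟩ := s.exists_max_image q hne
    have hpi := hpq i hi
    rw [← Finset.add_sum_erase s _ hi]
    have key : ∑ j ∈ s.erase i, (e (q j) - e (p j)) ≤ e (p i) - e a := by
      refine ih hpi.1 (he.mono (Icc_subset_Icc_right (hpi.2.1.trans hpi.2.2))) _ ?_ ?_ ?_ ?_
      · intro j hj
        have hjs := Finset.mem_of_mem_erase hj
        refine ⟨(hpq j hjs).1, (hpq j hjs).2.1, ?_⟩
        by_contra! hcon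
        have := hd hjs hi (Finset.ne_of_mem_erase hj)
        exact Set.disjoint_left.1 this ⟨hlt j hjs, le_rfl⟩ ⟨hcon, hmax j hjs⟩
      · exact hd.subset (by exact_mod_cast Finset.erase_subset _ _)
      · exact fun j hj => hlt j (Finset.mem_of_mem_erase hj)
      · rw [Finset.card_erase_of_mem hi, hn]; rfl
    have := he ⟨hpi.1.trans hpi.2.1, hpi.2.2⟩ ⟨hab, le_rfl⟩ hpi.2.2
    linarith

/-- Cauchy–Schwarz over disjoint intervals bounds the total displacement by the square root of total
length times total increment of `e`; the latter is at most `e b - e a` by monotonicity. -/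
theorem HasEnergyBound.absolutelyContinuousOnInterval {γ : ℝ → X} {e : ℝ → ℝ} {a b : ℝ}
    (hab : a ≤ b) (h : HasEnergyBound γ e a b) : AbsolutelyContinuousOnInterval γ a b := by
  rw [absolutelyContinuousOnInterval_iff]
  intro ε hε
  have hV : 0 ≤ e b - e a := sub_nonneg.2 (h.monotoneOn ⟨le_rfl, hab⟩ ⟨hab, le_rfl⟩ hab)
  refine ⟨ε ^ 2 / (e b - e a + 1), by positivity, fun ⟨n, I⟩ hI hlen => ?_⟩
  simp only [AbsolutelyContinuousOnInterval.disjWithin, mem_ofPred_eq, uIcc_of_le hab] at hI hlen ⊢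
  obtain ⟨hI₁, hI₂⟩ := hI
  set p : ℕ → ℝ := fun i => min (I i).1 (I i).2
  set q : ℕ → ℝ := fun i => max (I i).1 (I i).2
  have hmem : ∀ i ∈ Finset.range n, a ≤ p i ∧ p i ≤ q i ∧ q i ≤ b := fun i hi =>
    ⟨le_min (hI₁ i hi).1.1 (hI₁ i hi).2.1, min_le_max, max_le (hI₁ i hi).1.2 (hI₁ i hi).2.2⟩
  have hsum := sum_sub_le_of_pairwiseDisjoint hab h.monotoneOn (Finset.range n) p q hmem hI₂
  have hlen' : ∑ i ∈ Finset.range n, (q i - p i) < ε ^ 2 / (e b - e a + 1) := by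
    convert hlen using 2 with i
    rw [Real.dist_eq, max_sub_min_eq_abs']
  have hdist : ∀ i ∈ Finset.range n,
      dist (γ (I i).1) (γ (I i).2) ≤ √(q i - p i) * √(e (q i) - e (p i)) := by
    intro i hi
    have := h.dist_le_sqrt (hmem i hi).1 (hmem i hi).2.1 (hmem i hi).2.2
    rcases le_total (I i).1 (I i).2 with hle | hle
    · simpa [p, q, hle] using this
    · simpa [p, q, hle, dist_comm] using this
  refine (Finset.sum_le_sum hdist).trans_lt ?_
  refine (Real.sum_mul_le_sqrt_mul_sqrt _ _ _).trans_lt ?_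
  have e₁ : ∑ i ∈ Finset.range n, √(q i - p i) ^ 2 = ∑ i ∈ Finset.range n, (q i - p i) :=
    Finset.sum_congr rfl fun i hi => Real.sq_sqrt (sub_nonneg.2 (hmem i hi).2.1)
  have e₂ : ∑ i ∈ Finset.range n, √(e (q i) - e (p i)) ^ 2
      = ∑ i ∈ Finset.range n, (e (q i) - e (p i)) :=
    Finset.sum_congr rfl fun i hi => Real.sq_sqrt (sub_nonneg.2 (h.monotoneOn
      ⟨(hmem i hi).1, (hmem i hi).2.1.trans (hmem i hi).2.2⟩
      ⟨(hmem i hi).1.trans (hmem i hi).2.1, (hmem i hi).2.2⟩ (hmem i hi).2.1))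
  rw [e₁, e₂]
  have hL : 0 ≤ ∑ i ∈ Finset.range n, (q i - p i) :=
    Finset.sum_nonneg fun i hi => sub_nonneg.2 (hmem i hi).2.1
  rw [← Real.sqrt_mul hL, Real.sqrt_lt' hε]
  calc _ ≤ (∑ i ∈ Finset.range n, (q i - p i)) * (e b - e a + 1) := by
        gcongr; linarith
    _ < ε ^ 2 / (e b - e a + 1) * (e b - e a + 1) := by gcongr
    _ = ε ^ 2 := by field_simp

theorem _root_.AbsolutelyContinuousOnInterval.of_dist_le {Y Z : Type*} [PseudoMetricSpace Y]
    [PseudoMetricSpace Z] {f : ℝ → Y} {g : ℝ → Z} {a b : ℝ}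
    (hg : AbsolutelyContinuousOnInterval g a b)
    (h : ∀ s ∈ uIcc a b, ∀ t ∈ uIcc a b, dist (f s) (f t) ≤ dist (g s) (g t)) :
    AbsolutelyContinuousOnInterval f a b := by
  rw [absolutelyContinuousOnInterval_iff] at hg ⊢
  intro ε hε
  obtain ⟨δ, hδ, H⟩ := hg ε hε
  refine ⟨δ, hδ, fun E hE hlen => (Finset.sum_le_sum fun i hi => ?_).trans_lt (H E hE hlen)⟩
  exact h _ (hE.1 i hi).1 _ (hE.1 i hi).2

theorem IsACOn.absolutelyContinuousOnInterval {γ : ℝ → X} {a b : ℝ} (hab : a ≤ b)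
    (h : IsACOn γ a b) : AbsolutelyContinuousOnInterval γ a b := by
  obtain ⟨m, hm, hd⟩ := h
  have hi : IntervalIntegrable m volume a b :=
    (intervalIntegrable_iff_integrableOn_Icc_of_le hab).2 hm
  refine (hi.absolutelyContinuousOnInterval_intervalIntegral (c := a) (by simp)).of_dist_le ?_
  rw [uIcc_of_le hab]
  have key : ∀ s t, a ≤ s → s ≤ t → t ≤ b →
      dist (γ s) (γ t) ≤ dist (∫ v in a..s, m v) (∫ v in a..t, m v) := by
    intro s t hs hst ht
    refine (hd s t hs hst ht).trans ?_
    rw [dist_comm, Real.dist_eq, intervalIntegral.integral_interval_sub_left]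
    · exact le_abs_self _
    · exact hi.mono_set (by rw [uIcc_of_le hab, uIcc_of_le (hs.trans hst)]
                            exact Icc_subset_Icc_right ht)
    · exact hi.mono_set (by rw [uIcc_of_le hab, uIcc_of_le hs]
                            exact Icc_subset_Icc_right (hst.trans ht))
  intro s hs t ht
  rcases le_total s t with hst | hst
  · exact key s t hs.1 hst ht.2
  · rw [dist_comm, dist_comm (∫ v in a..s, m v)]
    exact key t s ht.1 hst hs.2

theorem absolutelyContinuousOnInterval_dist {γ : ℝ → X} {a b : ℝ}
    (h : AbsolutelyContinuousOnInterval γ a b) (z : X) :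
    AbsolutelyContinuousOnInterval (fun t => dist (γ t) z) a b :=
  h.of_dist_le fun _ _ _ _ => dist_dist_dist_le_left _ _ _

theorem continuousOn_of_absolutelyContinuousOnInterval {γ : ℝ → X} {a b : ℝ}
    (h : AbsolutelyContinuousOnInterval γ a b) : ContinuousOn γ (uIcc a b) := by
  intro t ht
  have h1 := (absolutelyContinuousOnInterval_dist h (γ t)).continuousOn t ht
  rw [ContinuousWithinAt, dist_self] at h1
  exact tendsto_iff_dist_tendsto_zero.2 h1

theorem HasEnergyBound.continuousOn {γ : ℝ → X} {e : ℝ → ℝ} {a b : ℝ}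
    (hab : a ≤ b) (h : HasEnergyBound γ e a b) : ContinuousOn γ (Icc a b) := by
  rw [← uIcc_of_le hab]
  exact continuousOn_of_absolutelyContinuousOnInterval (h.absolutelyContinuousOnInterval hab)

theorem IsACOn.continuousOn {γ : ℝ → X} {a b : ℝ} (hab : a ≤ b) (h : IsACOn γ a b) :
    ContinuousOn γ (Icc a b) := by
  rw [← uIcc_of_le hab]
  exact continuousOn_of_absolutelyContinuousOnInterval (h.absolutelyContinuousOnInterval hab)

/-- Real-valued distance functions let the fundamental theorem of calculus act on metric curves;
their derivatives are measurable and sit below the metric speed. -/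
theorem enorm_deriv_dist_le_metricSpeed (γ : ℝ → X) (z : X) (t : ℝ) :
    ‖deriv (fun s => dist (γ s) z) t‖ₑ ≤ metricSpeed γ t := by
  by_cases hd : DifferentiableAt ℝ (fun s => dist (γ s) z) t
  · have h1 := (hasDerivAt_iff_tendsto_slope.1 hd.hasDerivAt).enorm
    rw [← h1.limsup_eq]
    refine limsup_le_limsup ?_
    filter_upwards [self_mem_nhdsWithin] with s hs
    have hne : s - t ≠ 0 := sub_ne_zero.2 hs
    rw [_root_.slope_def_field, edist_dist, edist_dist, ← ENNReal.ofReal_div_of_pos (by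
      rw [dist_pos]; exact hs), ← ofReal_norm]
    apply ENNReal.ofReal_le_ofReal
    rw [norm_div, ← dist_eq_norm, ← dist_eq_norm]
    gcongr
    exact dist_dist_dist_le_left _ _ _
  · simp [deriv_zero_of_not_differentiableAt hd]

theorem HasEnergyBound.metricSpeed_le {γ : ℝ → X} {e : ℝ → ℝ} {a b t e' : ℝ}
    (h : HasEnergyBound γ e a b) (ht : t ∈ Ioo a b) (he : HasDerivAt e e' t) :
    metricSpeed γ t ≤ ENNReal.ofReal √e' := by
  have h1 : Tendsto (fun s => ENNReal.ofReal √(_root_.slope e t s)) (𝓝[≠] t)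
      (𝓝 (ENNReal.ofReal √e')) :=
    ENNReal.tendsto_ofReal ((hasDerivAt_iff_tendsto_slope.1 he).sqrt)
  rw [← h1.limsup_eq]
  refine limsup_le_limsup ?_
  filter_upwards [self_mem_nhdsWithin, nhdsWithin_le_nhds (isOpen_Ioo.mem_nhds ht)] with s hs hsI
  have hpos : 0 < dist s t := dist_pos.2 hs
  rw [edist_dist, edist_dist, ← ENNReal.ofReal_div_of_pos hpos]
  apply ENNReal.ofReal_le_ofReal
  apply Real.le_sqrt_of_sq_le
  rw [div_pow, div_le_iff₀ (by positivity), _root_.slope_def_field, Real.dist_eq, sq_abs]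
  have hne : s - t ≠ 0 := sub_ne_zero.2 hs
  have : (e s - e t) / (s - t) * (s - t) ^ 2 = (s - t) * (e s - e t) := by field_simp
  rw [this]
  rcases le_total s t with hst | hst
  · have := h s t hsI.1.le hst ht.2.le
    linarith
  · have := h t s ht.1.le hst hsI.2.le
    rw [dist_comm]
    linarith

theorem HasEnergyBound.ae_differentiableAt {γ : ℝ → X} {e : ℝ → ℝ} {a b : ℝ}
    (h : HasEnergyBound γ e a b) : ∀ᵐ t, t ∈ Ioo a b → DifferentiableAt ℝ e t := by
  filter_upwards [(h.monotoneOn.mono Ioo_subset_Icc_self).ae_differentiableWithinAt_of_mem]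
    with t ht hI
  exact (ht hI).differentiableAt (isOpen_Ioo.mem_nhds hI)

/-- Almost everywhere the squared speed is at most `e'`, and the derivative of a monotone function
integrates to at most its increment, even when `e` has jumps or a singular part. -/
theorem HasEnergyBound.lintegral_metricSpeed_sq_le {γ : ℝ → X} {e : ℝ → ℝ} {a b : ℝ}
    (hab : a ≤ b) (h : HasEnergyBound γ e a b) :
    ∫⁻ t in Ioo a b, metricSpeed γ t ^ 2 ≤ ENNReal.ofReal (e b - e a) := by
  have hmono : MonotoneOn e (uIcc a b) := by rw [uIcc_of_le hab]; exact h.monotoneOn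
  have hint := hmono.intervalIntegrable_deriv
  have hle := hmono.intervalIntegral_deriv_mem_uIcc
  rw [uIcc_of_le (sub_nonneg.2 (h.monotoneOn ⟨le_rfl, hab⟩ ⟨hab, le_rfl⟩ hab))] at hle
  have hnn : ∀ t ∈ Ioo a b, 0 ≤ deriv e t := fun t ht => by
    by_cases hd : DifferentiableAt ℝ e t
    · have := (h.monotoneOn.mono Ioo_subset_Icc_self).derivWithin_nonneg (x := t)
      rwa [derivWithin_of_isOpen isOpen_Ioo ht] at this
    · rw [deriv_zero_of_not_differentiableAt hd]
  calc ∫⁻ t in Ioo a b, metricSpeed γ t ^ 2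
      ≤ ∫⁻ t in Ioo a b, ENNReal.ofReal (deriv e t) := by
        refine lintegral_mono_ae ((ae_restrict_iff' measurableSet_Ioo).2 ?_)
        filter_upwards [h.ae_differentiableAt] with t ht hI
        calc metricSpeed γ t ^ 2 ≤ ENNReal.ofReal √(deriv e t) ^ 2 := by
              gcongr; exact h.metricSpeed_le hI (ht hI).hasDerivAt
          _ = ENNReal.ofReal (deriv e t) := by
              rw [← ENNReal.ofReal_pow (Real.sqrt_nonneg _), Real.sq_sqrt (hnn t hI)]
    _ = ENNReal.ofReal (∫ t in Ioo a b, deriv e t) := by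
        rw [ofReal_integral_eq_lintegral_ofReal]
        · exact ((intervalIntegrable_iff_integrableOn_Ioo_of_le hab).1 hint)
        · exact (ae_restrict_iff' measurableSet_Ioo).2 (ae_of_all _ hnn)
    _ ≤ _ := by
        apply ENNReal.ofReal_le_ofReal
        rw [← integral_Ioc_eq_integral_Ioo, ← intervalIntegral.integral_of_le hab]
        exact hle.2

/-- The `L¹` majorant is `√e'`, obtained by integrating the derivative of the distance to the fixed
point `γ s`. -/
theorem HasEnergyBound.isACOn {γ : ℝ → X} {e : ℝ → ℝ} {a b : ℝ}
    (hab : a ≤ b) (h : HasEnergyBound γ e a b) : IsACOn γ a b := by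
  have hmono : MonotoneOn e (uIcc a b) := by rw [uIcc_of_le hab]; exact h.monotoneOn
  have hint : IntegrableOn (fun t => √(deriv e t)) (Icc a b) := by
    have h1 := (intervalIntegrable_iff_integrableOn_Icc_of_le hab).1 hmono.intervalIntegrable_deriv
    refine Integrable.mono' (g := fun t => 1 + |deriv e t|) ?_ ?_ ?_
    · exact (integrable_const _).add h1.abs
    · exact (measurable_deriv e).sqrt.aestronglyMeasurable
    · refine ae_of_all _ fun t => ?_
      rw [Real.norm_of_nonneg (Real.sqrt_nonneg _)]
      refine Real.sqrt_le_iff.2 ⟨by positivity, ?_⟩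
      nlinarith [abs_nonneg (deriv e t), le_abs_self (deriv e t), sq_nonneg (deriv e t)]
  refine ⟨_, hint, fun s t hs hst ht => ?_⟩
  have hAC := (absolutelyContinuousOnInterval_dist (h.absolutelyContinuousOnInterval hab) (γ s)).mono
    (c := s) (d := t) (by rw [uIcc_of_le hab, uIcc_of_le hst]; exact Icc_subset_Icc hs ht)
  have hftc := hAC.integral_deriv_eq_sub
  simp only [dist_self, sub_zero] at hftc
  rw [dist_comm, ← hftc]
  refine intervalIntegral.integral_mono_ae_restrict hst hAC.intervalIntegrable_deriv ?_ ?_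
  · exact (intervalIntegrable_iff_integrableOn_Icc_of_le hst).2
      (hint.mono_set (Icc_subset_Icc hs ht))
  · rw [← restrict_Ioo_eq_restrict_Icc]
    refine (ae_restrict_iff' measurableSet_Ioo).2 ?_
    filter_upwards [h.ae_differentiableAt] with r hr hI
    have hI' : r ∈ Ioo a b := ⟨hs.trans_lt hI.1, hI.2.trans_le ht⟩
    have h1 := (enorm_deriv_dist_le_metricSpeed γ (γ s) r).trans
      (h.metricSpeed_le hI' (hr hI').hasDerivAt)
    rw [← ofReal_norm, ENNReal.ofReal_le_ofReal_iff (Real.sqrt_nonneg _)] at h1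
    exact (Real.le_norm_self _).trans h1

theorem HasEnergyBound.kinetic_le {γ : ℝ → X} {e : ℝ → ℝ} (h : HasEnergyBound γ e 0 1) :
    kinetic γ ≤ ENNReal.ofReal ((e 1 - e 0) / 2) := by
  rw [kinetic, if_pos (h.isACOn zero_le_one), div_eq_inv_mul, ENNReal.ofReal_mul (by norm_num)]
  gcongr
  · rw [ENNReal.ofReal_inv_of_pos (by norm_num)]; simp
  · exact h.lintegral_metricSpeed_sq_le zero_le_one

/-- The energy of an absolutely continuous curve on `[a, t]`. -/
noncomputable def energy (γ : ℝ → X) (a t : ℝ) : ℝ :=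
  (∫⁻ r in Ioo a t, metricSpeed γ r ^ 2).toReal

theorem sq_integral_le_mul_lintegral {f : ℝ → ℝ} {s t : ℝ} (hst : s ≤ t) (hf : Measurable f)
    (h : ∫⁻ r in Ioo s t, ‖f r‖ₑ ^ 2 < ⊤) :
    (∫ r in s..t, f r) ^ 2 ≤ (t - s) * (∫⁻ r in Ioo s t, ‖f r‖ₑ ^ 2).toReal := by
  have h1 : ENNReal.ofReal ((∫ r in s..t, f r) ^ 2)
      ≤ ENNReal.ofReal (t - s) * ∫⁻ r in Ioo s t, ‖f r‖ₑ ^ 2 := by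
    rw [intervalIntegral.integral_of_le hst, integral_Ioc_eq_integral_Ioo, ← sq_abs,
      ENNReal.ofReal_pow (abs_nonneg _), ← Real.norm_eq_abs, ofReal_norm]
    have h2 := ENNReal.lintegral_mul_le_Lp_mul_Lq (volume.restrict (Ioo s t))
      (p := 2) (q := 2) (Real.HolderConjugate.two_two) (f := fun _ => 1) (g := fun r => ‖f r‖ₑ)
      aemeasurable_const hf.enorm.aemeasurable
    simp only [Pi.mul_apply, one_mul, one_pow, lintegral_const, Measure.restrict_apply,
      MeasurableSet.univ, univ_inter, Real.volume_Ioo, ENNReal.rpow_two] at h2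
    calc _ ≤ (∫⁻ r in Ioo s t, ‖f r‖ₑ) ^ 2 := by gcongr; exact enorm_integral_le_lintegral_enorm _
      _ ≤ (ENNReal.ofReal (t - s) ^ (1 / 2 : ℝ) *
          (∫⁻ r in Ioo s t, ‖f r‖ₑ ^ 2) ^ (1 / 2 : ℝ)) ^ 2 := by gcongr
      _ = _ := by
        rw [mul_pow, ← ENNReal.rpow_two, ← ENNReal.rpow_two, ← ENNReal.rpow_mul,
          ← ENNReal.rpow_mul]
        norm_num
  have h3 := (ENNReal.ofReal_le_iff_le_toReal (ENNReal.mul_ne_top ENNReal.ofReal_ne_top h.ne)).1 h1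
  rwa [ENNReal.toReal_mul, ENNReal.toReal_ofReal (sub_nonneg.2 hst)] at h3

/-- Converse direction: integrate the derivative of `r ↦ d(γ r, γ s)` over `[s, t]`, apply
Cauchy–Schwarz, then dominate the integrand by the metric speed. -/
theorem IsACOn.hasEnergyBound {γ : ℝ → X} {a b : ℝ} (hab : a ≤ b) (h : IsACOn γ a b)
    (hfin : ∫⁻ t in Ioo a b, metricSpeed γ t ^ 2 < ⊤) :
    HasEnergyBound γ (energy γ a) a b := by
  intro s t hs hst ht
  have hAC := (absolutelyContinuousOnInterval_dist (h.absolutelyContinuousOnInterval hab) (γ s)).mono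
    (c := s) (d := t) (by rw [uIcc_of_le hab, uIcc_of_le hst]; exact Icc_subset_Icc hs ht)
  have hftc := hAC.integral_deriv_eq_sub
  simp only [dist_self, sub_zero] at hftc
  have hle : ∫⁻ r in Ioo s t, ‖deriv (fun r => dist (γ r) (γ s)) r‖ₑ ^ 2
      ≤ ∫⁻ r in Ioo s t, metricSpeed γ r ^ 2 :=
    lintegral_mono fun r => by gcongr; exact enorm_deriv_dist_le_metricSpeed γ (γ s) r
  have hfin' : ∀ c d, a ≤ c → d ≤ b → ∫⁻ r in Ioo c d, metricSpeed γ r ^ 2 ≠ ⊤ := fun c d hc hd =>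
    ((lintegral_mono_set (Ioo_subset_Ioo hc hd)).trans_lt hfin).ne
  have hdiff : energy γ a t - energy γ a s = (∫⁻ r in Ioo s t, metricSpeed γ r ^ 2).toReal := by
    have hsplit : ∫⁻ r in Ioo a t, metricSpeed γ r ^ 2
        = (∫⁻ r in Ioo a s, metricSpeed γ r ^ 2) + ∫⁻ r in Ioo s t, metricSpeed γ r ^ 2 := by
      rw [restrict_Ioo_eq_restrict_Ioc, ← Ioc_union_Ioc_eq_Ioc hs hst,
        lintegral_union measurableSet_Ioc (Ioc_disjoint_Ioc_of_le le_rfl),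
        ← restrict_Ioo_eq_restrict_Ioc, ← restrict_Ioo_eq_restrict_Ioc]
    rw [energy, energy, hsplit, ENNReal.toReal_add (hfin' _ _ le_rfl (hst.trans ht))
      (hfin' _ _ hs ht), add_sub_cancel_left]
  rw [hdiff, dist_comm, ← hftc]
  refine (sq_integral_le_mul_lintegral hst (measurable_deriv _)
    (hle.trans_lt (lt_top_iff_ne_top.2 (hfin' _ _ hs ht)))).trans ?_
  exact mul_le_mul_of_nonneg_left (ENNReal.toReal_mono (hfin' _ _ hs ht) hle) (by linarith)

theorem kinetic_lt_top_iff {γ : ℝ → X} : kinetic γ < ⊤ ↔ IsAC2 γ := by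
  unfold kinetic IsAC2
  split_ifs with h
  · simp only [h, true_and]
    constructor
    · intro h1
      by_contra h2
      rw [not_lt, top_le_iff] at h2
      simp [h2] at h1
    · exact fun h1 => ENNReal.mul_lt_top (by simp) h1
  · simp [h]

theorem IsAC2.hasEnergyBound {γ : ℝ → X} (h : IsAC2 γ) : HasEnergyBound γ (energy γ 0) 0 1 :=
  h.1.hasEnergyBound zero_le_one h.2

theorem energy_self (γ : ℝ → X) (a : ℝ) : energy γ a a = 0 := by simp [energy]

theorem IsAC2.energy_eq {γ : ℝ → X} (h : IsAC2 γ) : energy γ 0 1 = 2 * (kinetic γ).toReal := by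
  rw [kinetic, if_pos h.1, energy, ENNReal.toReal_mul]
  simp

end EnergyBounds

/-! ### From the differential EVI to integrated inequalities and energy decay. -/

section Flows

variable {X : Type*} [MetricSpace X]

theorem continuousOn_dist_sq {u : ℝ → X} {S : Set ℝ} (h : ContinuousOn u S) (y : X) :
    ContinuousOn (fun r => dist (u r) y ^ 2) S :=
  (continuous_dist.comp_continuousOn (h.prodMk continuousOn_const)).pow 2

/-- A short-time Grönwall estimate. -/
theorem le_two_mul_of_le_add_integral {ψ : ℝ → ℝ} {a b A κ : ℝ}
    (hψ : ContinuousOn ψ (Icc a b)) (hnn : ∀ t ∈ Icc a b, 0 ≤ ψ t) (hκ : 0 ≤ κ)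
    (hsmall : κ * (b - a) ≤ 1 / 2)
    (h : ∀ t ∈ Icc a b, ψ t ≤ A + κ * ∫ r in a..t, ψ r) :
    ∀ t ∈ Icc a b, ψ t ≤ 2 * A := by
  intro t₀ ht₀
  -- At a maximum point the integral is at most `(t - a) * ψ t`, so the smallness condition absorbs
  -- it into half of the left side.
  obtain ⟨t, ht, hmax⟩ := isCompact_Icc.exists_isMaxOn ⟨t₀, ht₀⟩ hψ
  have h1 : ∫ r in a..t, ψ r ≤ (t - a) * ψ t := by
    have hsub : Icc a t ⊆ Icc a b := Icc_subset_Icc_right ht.2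
    calc ∫ r in a..t, ψ r ≤ ∫ _ in a..t, ψ t := by
          refine intervalIntegral.integral_mono_on ht.1 ?_ (by simp) fun r hr => hmax (hsub hr)
          exact (hψ.mono hsub).intervalIntegrable_of_Icc ht.1
      _ = (t - a) * ψ t := by simp
  have h2 := h t ht
  have h3 : κ * ∫ r in a..t, ψ r ≤ 1 / 2 * ψ t := by
    calc κ * ∫ r in a..t, ψ r ≤ κ * ((t - a) * ψ t) := by gcongr
      _ = (κ * (t - a)) * ψ t := by ring
      _ ≤ 1 / 2 * ψ t := by
        have := hnn t ht
        gcongr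
        refine le_trans ?_ hsmall
        have := ht.2
        gcongr
  have h4 : ψ t₀ ≤ ψ t := hmax ht₀
  linarith

/-- The form of the evolution variational inequality used below: `u : [0, ∞) → X` is continuous,
`E` is nonincreasing along `u` and finite at positive times, and the inequality holds in integrated
form with `E (u r)` bounded below by `E (u t)`. -/
structure IsDescentCurve (E : X → EReal) (κ : ℝ) (u : ℝ → X) : Prop where
  nonneg : 0 ≤ κ
  cont : ContinuousOn u (Ici 0)
  lt_top : ∀ t, 0 < t → E (u t) < ⊤
  anti : ∀ s t, 0 ≤ s → s ≤ t → E (u t) ≤ E (u s)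
  weak : ∀ y, E y < ⊤ → ∀ s t, 0 ≤ s → s ≤ t → 0 < t →
    dist (u t) y ^ 2 / 2 + (t - s) * (E (u t)).toReal
      ≤ dist (u s) y ^ 2 / 2 + (t - s) * (E y).toReal
        + κ / 2 * ∫ r in s..t, dist (u r) y ^ 2

theorem IsAdmissibleEnergy.ne_bot {E : X → EReal} (hE : IsAdmissibleEnergy E) (z : X) :
    E z ≠ ⊥ := by
  obtain ⟨c, hc⟩ := hE.bddBelow {z} Bornology.isBounded_singleton
  exact ((EReal.bot_lt_coe c).trans_le (hc z rfl)).ne'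

theorem IsAdmissibleEnergy.coe_toReal {E : X → EReal} (hE : IsAdmissibleEnergy E) {z : X}
    (hz : E z < ⊤) : ((E z).toReal : EReal) = E z :=
  EReal.coe_toReal hz.ne (hE.ne_bot z)

theorem IsAdmissibleEnergy.toReal_le {E : X → EReal} (hE : IsAdmissibleEnergy E) {z w : X}
    (hw : E w < ⊤) (h : E z ≤ E w) : (E z).toReal ≤ (E w).toReal :=
  EReal.toReal_le_toReal h (hE.ne_bot z) hw.ne

theorem IsEVIFlow.continuousOn {E : X → EReal} {lam : ℝ} {x : X} {γ : ℝ → X}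
    (h : IsEVIFlow E lam x γ) : ContinuousOn γ (Ioi 0) := by
  intro t ht
  have ht' : (0 : ℝ) < t := ht
  have h1 := (h.ac_loc (t / 2) (t + 1) (by linarith) (by linarith)).continuousOn (by linarith)
  exact (h1.continuousAt (Icc_mem_nhds (by linarith) (by linarith))).continuousWithinAt

theorem IsEVIFlow.ae_le {E : X → EReal} (hE : IsAdmissibleEnergy E) {lam : ℝ} {x : X} {γ : ℝ → X}
    (h : IsEVIFlow E lam x γ) {y : X} (hy : E y < ⊤) :
    ∀ᵐ t, 0 < t → E (γ t) < ⊤ ∧ 1 / 2 * deriv (fun s => dist (γ s) y ^ 2) t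
      + lam / 2 * dist (γ t) y ^ 2 + (E (γ t)).toReal ≤ (E y).toReal := by
  filter_upwards [(ae_restrict_iff' measurableSet_Ioi).1 (h.evi y)] with t ht hpos
  have h1 := ht hpos
  have hlt : E (γ t) < ⊤ := by
    by_contra hcon
    rw [not_lt, top_le_iff] at hcon
    rw [hcon, EReal.coe_add_top, top_le_iff] at h1
    exact hy.ne h1
  refine ⟨hlt, ?_⟩
  rw [← hE.coe_toReal hlt, ← hE.coe_toReal hy] at h1
  exact_mod_cast h1

/-- The compact image of the curve gives a lower bound for `E`; the EVI itself, tested with one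
point of the domain, gives an integrable upper bound. -/
theorem IsEVIFlow.intervalIntegrable {E : X → EReal} (hE : IsAdmissibleEnergy E) {lam : ℝ} {x : X}
    {γ : ℝ → X} (h : IsEVIFlow E lam x γ) {s t : ℝ} (hs : 0 < s) (hst : s ≤ t) :
    IntervalIntegrable (fun r => (E (γ r)).toReal) volume s t := by
  obtain ⟨y, hy⟩ := hE.dense_domain.nonempty_iff.2 ⟨x⟩
  have hcont : ContinuousOn γ (Icc s t) := h.continuousOn.mono fun r hr => hs.trans_le hr.1
  obtain ⟨c, hc⟩ := hE.bddBelow _ (isCompact_Icc.image_of_continuousOn hcont).isBounded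
  have hAC := absolutelyContinuousOnInterval_dist
    ((h.ac_loc s t hs hst).absolutelyContinuousOnInterval hst) y
  have hAC2 := hAC.fun_mul hAC
  simp only [← sq] at hAC2
  have hD := (intervalIntegrable_iff_integrableOn_Icc_of_le hst).1 hAC2.intervalIntegrable_deriv
  have hd : IntegrableOn (fun r => dist (γ r) y ^ 2) (Icc s t) :=
    (continuousOn_dist_sq hcont y).integrableOn_Icc
  rw [intervalIntegrable_iff_integrableOn_Icc_of_le hst]
  let _ : MeasurableSpace X := borel X
  have _ : BorelSpace X := ⟨rfl⟩
  refine Integrable.mono' (g := fun r => |c| + (|(E y).toReal|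
    + |1 / 2 * deriv (fun s => dist (γ s) y ^ 2) r| + |lam / 2 * dist (γ r) y ^ 2|)) ?_ ?_ ?_
  · exact (integrable_const _).add (((integrable_const _).add (hD.const_mul _).abs).add
      (hd.const_mul _).abs)
  · exact ((measurable_ereal_toReal.comp hE.lsc.measurable).comp_aemeasurable
      (hcont.aemeasurable measurableSet_Icc)).aestronglyMeasurable
  · refine (ae_restrict_iff' measurableSet_Icc).2 ?_
    filter_upwards [h.ae_le hE hy] with r hr hI
    obtain ⟨h1, h2⟩ := hr (hs.trans_le hI.1)
    have h3 : c ≤ (E (γ r)).toReal := by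
      have := hc _ (mem_image_of_mem γ hI)
      rw [← hE.coe_toReal h1] at this
      exact_mod_cast this
    rw [Real.norm_eq_abs, abs_le]
    have := neg_abs_le c
    have := abs_nonneg c
    have := le_abs_self (E y).toReal
    have := neg_abs_le (1 / 2 * deriv (fun s => dist (γ s) y ^ 2) r)
    have := neg_abs_le (lam / 2 * dist (γ r) y ^ 2)
    have := abs_nonneg (E y).toReal
    have := abs_nonneg (1 / 2 * deriv (fun s => dist (γ s) y ^ 2) r)
    have := abs_nonneg (lam / 2 * dist (γ r) y ^ 2)
    constructor <;> linarith

theorem IsEVIFlow.integrated {E : X → EReal} (hE : IsAdmissibleEnergy E) {lam κ : ℝ} {x : X}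
    {γ : ℝ → X} (h : IsEVIFlow E lam x γ) (hκ : -lam ≤ κ) {y : X} (hy : E y < ⊤) {s t : ℝ}
    (hs : 0 < s) (hst : s ≤ t) :
    dist (γ t) y ^ 2 / 2 + ∫ r in s..t, (E (γ r)).toReal
      ≤ dist (γ s) y ^ 2 / 2 + (t - s) * (E y).toReal + κ / 2 * ∫ r in s..t, dist (γ r) y ^ 2 := by
  have hcont : ContinuousOn γ (Icc s t) := h.continuousOn.mono fun r hr => hs.trans_le hr.1
  have hAC := absolutelyContinuousOnInterval_dist
    ((h.ac_loc s t hs hst).absolutelyContinuousOnInterval hst) y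
  have hAC2 := hAC.fun_mul hAC
  simp only [← sq] at hAC2
  have hD := hAC2.intervalIntegrable_deriv
  have hftc := hAC2.integral_deriv_eq_sub
  have hd : IntervalIntegrable (fun r => dist (γ r) y ^ 2) volume s t :=
    (continuousOn_dist_sq hcont y).intervalIntegrable_of_Icc hst
  have hg := h.intervalIntegrable hE hs hst
  have key : ∫ r in s..t, (1 / 2 * deriv (fun s => dist (γ s) y ^ 2) r + (E (γ r)).toReal)
      ≤ ∫ r in s..t, ((E y).toReal + κ / 2 * dist (γ r) y ^ 2) := by
    refine intervalIntegral.integral_mono_ae_restrict hst ((hD.const_mul _).add hg)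
      (intervalIntegrable_const.add (hd.const_mul _)) ?_
    refine (ae_restrict_iff' measurableSet_Icc).2 ?_
    filter_upwards [h.ae_le hE hy] with r hr hI
    have h2 := (hr (hs.trans_le hI.1)).2
    have h3 : -lam * dist (γ r) y ^ 2 ≤ κ * dist (γ r) y ^ 2 := by gcongr
    linarith
  rw [intervalIntegral.integral_add (hD.const_mul _) hg,
    intervalIntegral.integral_add intervalIntegrable_const (hd.const_mul _),
    intervalIntegral.integral_const_mul, intervalIntegral.integral_const_mul, hftc,
    intervalIntegral.integral_const, smul_eq_mul] at key
  linarith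

/-- If the energy rose, consider the last time `s₁` in the sublevel set. Testing the EVI with `γ s₁`
makes the energy terms favourable afterwards, and Grönwall with zero data freezes the curve at `γ
s₁`, a contradiction. -/
theorem IsEVIFlow.antitone {E : X → EReal} (hE : IsAdmissibleEnergy E) {lam : ℝ} {x : X}
    {γ : ℝ → X} (h : IsEVIFlow E lam x γ) {s₀ t₀ : ℝ} (hs₀ : 0 < s₀) (hst₀ : s₀ ≤ t₀) :
    E (γ t₀) ≤ E (γ s₀) := by
  by_contra! hlt
  set c := E (γ s₀) with hc
  have hc_top : c < ⊤ := hlt.trans_le le_top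
  have hcont : ContinuousOn γ (Icc s₀ t₀) := h.continuousOn.mono fun r hr => hs₀.trans_le hr.1
  have hclosed : IsClosed (Icc s₀ t₀ ∩ γ ⁻¹' (E ⁻¹' Iic c)) :=
    hcont.preimage_isClosed_of_isClosed isClosed_Icc (hE.lsc.isClosed_preimage c)
  have hcomp : IsCompact (Icc s₀ t₀ ∩ γ ⁻¹' (E ⁻¹' Iic c)) :=
    isCompact_Icc.of_isClosed_subset hclosed inter_subset_left
  obtain ⟨s₁, ⟨hs₁, hE₁⟩, hmax⟩ := hcomp.exists_isGreatest ⟨s₀, ⟨le_rfl, hst₀⟩, le_refl c⟩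
  have hE₁' : E (γ s₁) ≤ c := hE₁
  have hpos : 0 < s₁ := hs₀.trans_le hs₁.1
  have hlt₁ : s₁ < t₀ := by
    refine hs₁.2.lt_of_ne fun heq => ?_
    rw [heq] at hE₁'
    exact hlt.not_ge hE₁'
  have habove : ∀ t, s₁ < t → t ≤ t₀ → c < E (γ t) := by
    intro t h1 h2
    by_contra! hcon
    exact h1.not_ge (hmax ⟨⟨hs₁.1.trans h1.le, h2⟩, hcon⟩)
  have htop₁ : E (γ s₁) < ⊤ := hE₁'.trans_lt hc_top
  set κ := |lam|
  have hκ : 0 ≤ κ := abs_nonneg _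
  -- The step length makes `κ * (b - s₁) ≤ 1 / 2` and remains meaningful when `κ = 0`.
  set b := min t₀ (s₁ + 1 / (2 * κ + 1)) with hb
  have hb₁ : s₁ < b := lt_min hlt₁ (by have : 0 < 1 / (2 * κ + 1) := by positivity
                                       linarith)
  have hbt : b ≤ t₀ := min_le_left _ _
  have hzero := le_two_mul_of_le_add_integral (ψ := fun r => dist (γ r) (γ s₁) ^ 2) (a := s₁)
    (b := b) (A := 0) (κ := κ)
    (continuousOn_dist_sq (hcont.mono (Icc_subset_Icc hs₁.1 hbt)) _)
    (fun _ _ => by positivity) hκ ?_ ?_ b ⟨hb₁.le, le_rfl⟩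
  · have hd : dist (γ b) (γ s₁) = 0 := by
      have : dist (γ b) (γ s₁) ^ 2 = 0 := le_antisymm (by simpa using hzero) (by positivity)
      simpa using this
    have := habove b hb₁ hbt
    rw [dist_eq_zero.1 hd] at this
    exact this.not_ge hE₁'
  · have : b - s₁ ≤ 1 / (2 * κ + 1) := by
      have := min_le_right t₀ (s₁ + 1 / (2 * κ + 1)); linarith
    calc κ * (b - s₁) ≤ κ * (1 / (2 * κ + 1)) := by gcongr
      _ ≤ 1 / 2 := by rw [mul_one_div, div_le_div_iff₀ (by positivity) (by norm_num)]; linarith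
  · intro t ht
    have h1 := h.integrated hE (κ := κ) (neg_le_abs lam) htop₁ hpos ht.1
    have h2 : (t - s₁) * (E (γ s₁)).toReal ≤ ∫ r in s₁..t, (E (γ r)).toReal := by
      calc (t - s₁) * (E (γ s₁)).toReal = ∫ _ in s₁..t, (E (γ s₁)).toReal := by simp
        _ ≤ _ := by
          refine intervalIntegral.integral_mono_ae_restrict ht.1 (by simp)
            (h.intervalIntegrable hE hpos ht.1) ?_
          rw [← restrict_Ioo_eq_restrict_Icc]
          refine (ae_restrict_iff' measurableSet_Ioo).2 ?_
          filter_upwards [h.ae_le hE htop₁] with r hr hI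
          exact hE.toReal_le (hr (hpos.trans hI.1)).1
            (hE₁'.trans (habove r hI.1 (hI.2.le.trans (ht.2.trans hbt))).le)
    simp only [dist_self] at h1
    linarith

/-- An `EVI` flow, extended by its starting point, is a descent curve. -/
theorem IsEVIFlow.exists_isDescentCurve {E : X → EReal} (hE : IsAdmissibleEnergy E) {lam : ℝ}
    {x : X} {γ : ℝ → X} (h : IsEVIFlow E lam x γ) :
    ∃ u : ℝ → X, u 0 = x ∧ IsDescentCurve E |lam| u := by
  classical
  set u : ℝ → X := fun t => if t ≤ 0 then x else γ t with hu
  have hu0 : u 0 = x := by simp [hu]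
  have hupos : ∀ t, 0 < t → u t = γ t := fun t ht => by simp [hu, not_le.2 ht]
  have hcont : ContinuousOn u (Ici 0) := by
    intro t ht
    rcases (mem_Ici.1 ht).eq_or_lt with rfl | hpos
    · rw [continuousWithinAt_Ioi_iff_Ici.symm, ContinuousWithinAt, hu0]
      exact h.start.congr' (eventually_mem_nhdsWithin.mono fun t ht => (hupos t ht).symm)
    · refine ContinuousAt.continuousWithinAt ?_
      refine (h.continuousOn.continuousAt (Ioi_mem_nhds hpos)).congr ?_
      exact (Ioi_mem_nhds hpos |> Filter.eventually_iff.2 |>.mono fun t ht => (hupos t ht).symm)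
  have hlt : ∀ t, 0 < t → E (γ t) < ⊤ := by
    intro t ht
    obtain ⟨y, hy⟩ := hE.dense_domain.nonempty_iff.2 ⟨x⟩
    -- Finiteness is known only for almost every time; one earlier good time and monotonicity give
    -- it at `t`.
    have h1 : ∃ᵐ r ∂(volume.restrict (Ioo 0 t)), E (γ r) < ⊤ := by
      have : NeZero (volume.restrict (Ioo 0 t)) := ⟨by simp [ht]⟩
      refine Eventually.frequently ((ae_restrict_iff' measurableSet_Ioo).2 ?_)
      filter_upwards [h.ae_le hE hy] with r hr hI using (hr hI.1).1
    obtain ⟨r, hr, hI⟩ := (h1.and_eventually (ae_restrict_mem measurableSet_Ioo)).exists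
    exact (h.antitone hE hI.1 hI.2.le).trans_lt hr
  have hweak_pos : ∀ y, E y < ⊤ → ∀ s t, 0 < s → s ≤ t →
      dist (u t) y ^ 2 / 2 + (t - s) * (E (u t)).toReal
      ≤ dist (u s) y ^ 2 / 2 + (t - s) * (E y).toReal
        + |lam| / 2 * ∫ r in s..t, dist (u r) y ^ 2 := by
    intro y hy s t hs hst
    have h1 := h.integrated hE (κ := |lam|) (neg_le_abs lam) hy hs hst
    have h2 : (t - s) * (E (γ t)).toReal ≤ ∫ r in s..t, (E (γ r)).toReal := by
      calc (t - s) * (E (γ t)).toReal = ∫ _ in s..t, (E (γ t)).toReal := by simp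
        _ ≤ _ := by
          refine intervalIntegral.integral_mono_on hst (by simp)
            (h.intervalIntegrable hE hs hst) fun r hr => ?_
          exact hE.toReal_le (hlt r (hs.trans_le hr.1)) (h.antitone hE (hs.trans_le hr.1) hr.2)
    have h3 : ∫ r in s..t, dist (u r) y ^ 2 = ∫ r in s..t, dist (γ r) y ^ 2 := by
      refine intervalIntegral.integral_congr fun r hr => ?_
      rw [uIcc_of_le hst] at hr
      simp only [hupos r (hs.trans_le hr.1)]
    rw [hupos t (hs.trans_le hst), hupos s hs, h3]
    linarith
  have hweak : ∀ y, E y < ⊤ → ∀ s t, 0 ≤ s → s ≤ t → 0 < t →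
      dist (u t) y ^ 2 / 2 + (t - s) * (E (u t)).toReal
      ≤ dist (u s) y ^ 2 / 2 + (t - s) * (E y).toReal
        + |lam| / 2 * ∫ r in s..t, dist (u r) y ^ 2 := by
    intro y hy s t hs hst ht
    rcases hs.eq_or_lt with rfl | hs'
    · have hl : Tendsto (fun s => dist (u t) y ^ 2 / 2 + (t - s) * (E (u t)).toReal) (𝓝[>] 0)
          (𝓝 (dist (u t) y ^ 2 / 2 + (t - 0) * (E (u t)).toReal)) :=
        (Continuous.tendsto (by fun_prop) _).mono_left nhdsWithin_le_nhds
      have hr : Tendsto (fun s => dist (u s) y ^ 2 / 2 + (t - s) * (E y).toReal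
          + |lam| / 2 * ∫ r in (0 : ℝ)..t, dist (u r) y ^ 2) (𝓝[>] 0)
          (𝓝 (dist (u 0) y ^ 2 / 2 + (t - 0) * (E y).toReal
          + |lam| / 2 * ∫ r in (0 : ℝ)..t, dist (u r) y ^ 2)) := by
        have h1 : Tendsto u (𝓝[>] 0) (𝓝 (u 0)) :=
          (hcont 0 self_mem_Ici).mono_left (nhdsWithin_mono _ Ioi_subset_Ici_self)
        have h2 : Tendsto (fun s : ℝ => (t - s) * (E y).toReal) (𝓝[>] 0)
            (𝓝 ((t - 0) * (E y).toReal)) :=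
          (Continuous.tendsto (by fun_prop) _).mono_left nhdsWithin_le_nhds
        exact ((((h1.dist tendsto_const_nhds).pow 2).div_const 2).add h2).add_const _
      -- Starting time `0` is reached as a limit; enlarging the integral from `[s, t]` to `[0, t]`
      -- only weakens the bound, so only the endpoint terms need to converge.
      refine le_of_tendsto_of_tendsto hl hr ?_
      filter_upwards [Ioo_mem_nhdsGT ht] with s hs
      refine (hweak_pos y hy s t hs.1 hs.2.le).trans ?_
      gcongr
      have hint : ∀ a b, 0 ≤ a → 0 ≤ b →
          IntervalIntegrable (fun r => dist (u r) y ^ 2) volume a b := fun a b ha hb =>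
        (continuousOn_dist_sq (hcont.mono fun r hr => (le_min ha hb).trans hr.1)
          y).intervalIntegrable
      rw [← intervalIntegral.integral_add_adjacent_intervals (hint 0 s le_rfl hs.1.le)
        (hint s t hs.1.le ht.le)]
      have : 0 ≤ ∫ r in (0 : ℝ)..s, dist (u r) y ^ 2 :=
        intervalIntegral.integral_nonneg hs.1.le fun r _ => by positivity
      linarith
    · exact hweak_pos y hy s t hs' hst
  refine ⟨u, hu0, abs_nonneg _, hcont, fun t ht => by rw [hupos t ht]; exact hlt t ht, ?_, hweak⟩
  intro s t hs hst
  rcases hs.eq_or_lt with rfl | hs'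
  swap
  · rw [hupos s hs', hupos t (hs'.trans_le hst)]
    exact h.antitone hE hs' hst
  rcases hst.eq_or_lt with rfl | ht
  · exact le_rfl
  -- The freezing argument of `IsEVIFlow.antitone` again, now started at time `0`: the energy
  -- exceeds `E (u 0)` on all of `(0, t]`, and testing with `u 0` forces `u` to stay there.
  by_contra! hcon
  have htop : E (u 0) < ⊤ := hcon.trans_le le_top
  set κ := |lam|
  have hκ : 0 ≤ κ := abs_nonneg _
  set b := min t (1 / (2 * κ + 1)) with hb
  have hb₁ : 0 < b := lt_min ht (by positivity)
  have hbt : b ≤ t := min_le_left _ _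
  have hge : ∀ r, 0 < r → r ≤ t → E (u 0) < E (u r) := by
    intro r h1 h2
    refine hcon.trans_le ?_
    rw [hupos r h1, hupos t ht]
    exact h.antitone hE h1 h2
  have hzero := le_two_mul_of_le_add_integral (ψ := fun r => dist (u r) (u 0) ^ 2) (a := 0)
    (b := b) (A := 0) (κ := κ)
    (continuousOn_dist_sq (hcont.mono fun r hr => hr.1) _)
    (fun _ _ => by positivity) hκ ?_ ?_ b ⟨hb₁.le, le_rfl⟩
  · have hd : dist (u b) (u 0) = 0 := by
      have : dist (u b) (u 0) ^ 2 = 0 := le_antisymm (by simpa using hzero) (by positivity)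
      simpa using this
    have := hge b hb₁ hbt
    rw [dist_eq_zero.1 hd] at this
    exact lt_irrefl _ this
  · have : b - 0 ≤ 1 / (2 * κ + 1) := by
      have := min_le_right t (1 / (2 * κ + 1)); linarith
    calc κ * (b - 0) ≤ κ * (1 / (2 * κ + 1)) := by gcongr
      _ ≤ 1 / 2 := by rw [mul_one_div, div_le_div_iff₀ (by positivity) (by norm_num)]; linarith
  · intro r hr
    rcases hr.1.eq_or_lt with rfl | hr'
    · simp
    have h1 := hweak (u 0) htop 0 r le_rfl hr.1 hr'
    have h2 : (E (u 0)).toReal ≤ (E (u r)).toReal :=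
      hE.toReal_le (by rw [hupos r hr']; exact hlt r hr') (hge r hr' (hr.2.trans hbt)).le
    simp only [dist_self] at h1
    nlinarith

end Flows

/-! ### Dissipation, slope bounds, contraction and regularisation along descent curves. -/

section Descent

variable {X : Type*} [MetricSpace X] {E : X → EReal} {κ : ℝ} {u v : ℝ → X}

theorem IsDescentCurve.toReal_anti (hE : IsAdmissibleEnergy E) (h : IsDescentCurve E κ u)
    {s t : ℝ} (hs : 0 ≤ s) (hst : s ≤ t) (hfin : E (u s) < ⊤) :
    (E (u t)).toReal ≤ (E (u s)).toReal :=
  hE.toReal_le hfin (h.anti s t hs hst)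

/-- Test the inequality with the curve's own point `u s`; the remaining `κ` integral is absorbed by
the short-time Grönwall estimate, which turns the factor 2 into 4. -/
theorem IsDescentCurve.dist_sq_le (hE : IsAdmissibleEnergy E) (h : IsDescentCurve E κ u)
    {s t : ℝ} (hs : 0 ≤ s) (hst : s ≤ t) (hfin : E (u s) < ⊤) (hsmall : κ * (t - s) ≤ 1 / 2) :
    dist (u s) (u t) ^ 2 ≤ 4 * (t - s) * ((E (u s)).toReal - (E (u t)).toReal) := by
  have key := le_two_mul_of_le_add_integral (ψ := fun r => dist (u r) (u s) ^ 2) (a := s) (b := t)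
    (A := 2 * (t - s) * ((E (u s)).toReal - (E (u t)).toReal)) (κ := κ)
    (continuousOn_dist_sq (h.cont.mono fun r hr => hs.trans hr.1) _)
    (fun _ _ => by positivity) h.nonneg hsmall ?_ t ⟨hst, le_rfl⟩
  · rw [dist_comm]
    linarith
  · intro r hr
    have h1 := h.toReal_anti hE hs hr.1 hfin
    have h2 := h.toReal_anti hE (hs.trans hr.1) hr.2 ((h.anti s r hs hr.1).trans_lt hfin)
    have hnn : 0 ≤ 2 * (t - s) * ((E (u s)).toReal - (E (u t)).toReal) :=
      mul_nonneg (by linarith) (by linarith)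
    rcases hr.1.eq_or_lt with rfl | hlt
    · simpa using hnn
    have h3 := h.weak (u s) hfin s r hs hr.1 (hs.trans_lt hlt)
    simp only [dist_self] at h3
    have h4 : (r - s) * ((E (u s)).toReal - (E (u r)).toReal)
        ≤ (t - s) * ((E (u s)).toReal - (E (u t)).toReal) := by
      have := hr.2
      have := hr.1
      gcongr
    linarith

theorem IsAdmissibleEnergy.eventually_lt_toReal (hE : IsAdmissibleEnergy E) {z : X} {c : ℝ}
    (hz : E z < ⊤) (hc : c < (E z).toReal) : ∀ᶠ w in 𝓝 z, E w < ⊤ → c < (E w).toReal := by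
  have h1 : (c : EReal) < E z := by
    rw [← hE.coe_toReal hz]; exact_mod_cast hc
  filter_upwards [hE.lsc z _ h1] with w hw hfin
  rw [← hE.coe_toReal hfin] at hw
  exact_mod_cast hw

/-- For points in a right neighbourhood, all intermediate times have the given property. -/
theorem eventually_forall_Icc {p : ℝ → Prop} {s : ℝ} (h : ∀ᶠ r in 𝓝[≥] s, p r) :
    ∀ᶠ t in 𝓝[>] s, ∀ r ∈ Icc s t, p r := by
  obtain ⟨b, hb, hsub⟩ := mem_nhdsGE_iff_exists_Ico_subset.1 h
  filter_upwards [Ioo_mem_nhdsGT hb] with t ht r hr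
  exact hsub ⟨hr.1, hr.2.trans_lt ht.2⟩

/-- Over a short step the squared distance to `y` decreases by at most about `2 * K * (t - s) * dist
(u s) y`. Dividing the integrated inequality by `t - s` leaves the claim with `E (u t)`, and lower
semicontinuity replaces it by `E (u s)`. -/
theorem IsDescentCurve.le_of_frequently_dist_le (hE : IsAdmissibleEnergy E)
    (h : IsDescentCurve E κ u) {s K : ℝ} (hs : 0 ≤ s) (hfin : E (u s) < ⊤) (hK : 0 ≤ K)
    (hfreq : ∃ᶠ t in 𝓝[>] s, dist (u s) (u t) ≤ K * (t - s)) {y : X} (hy : E y < ⊤) :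
    (E (u s)).toReal ≤ (E y).toReal + K * dist (u s) y + κ / 2 * dist (u s) y ^ 2 := by
  set a := dist (u s) y with ha
  have hlim : Tendsto (fun η : ℝ => (E y).toReal + K * (a + η) + κ / 2 * (a + η) ^ 2 + η)
      (𝓝[>] 0) (𝓝 ((E y).toReal + K * (a + 0) + κ / 2 * (a + 0) ^ 2 + 0)) :=
    (Continuous.tendsto (by fun_prop) _).mono_left nhdsWithin_le_nhds
  simp only [add_zero] at hlim
  refine ge_of_tendsto hlim ?_
  filter_upwards [self_mem_nhdsWithin] with η hη
  have hη' : 0 < η := hη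
  have hcs : Tendsto u (𝓝[≥] s) (𝓝 (u s)) := (h.cont s hs).mono fun r hr => hs.trans hr
  have e1 : ∀ᶠ r in 𝓝[≥] s, dist (u r) y < a + η :=
    (hcs.dist tendsto_const_nhds).eventually (gt_mem_nhds (by linarith))
  have e2 : ∀ᶠ t in 𝓝[>] s, E (u t) < ⊤ → (E (u s)).toReal - η < (E (u t)).toReal :=
    (hcs.mono_left (nhdsWithin_mono _ Ioi_subset_Ici_self)).eventually
      (hE.eventually_lt_toReal hfin (by linarith))
  obtain ⟨t, ⟨hd, ht1, ht2⟩, hst⟩ := ((hfreq.and_eventually ((eventually_forall_Icc e1).and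
    e2)).and_eventually self_mem_nhdsWithin).exists
  have hst' : s < t := hst
  have htop := h.lt_top t (hs.trans_lt hst')
  have ht3 := ht2 htop
  have hw := h.weak y hy s t hs hst'.le (hs.trans_lt hst')
  have hint : ∫ r in s..t, dist (u r) y ^ 2 ≤ (t - s) * (a + η) ^ 2 := by
    calc ∫ r in s..t, dist (u r) y ^ 2 ≤ ∫ _ in s..t, (a + η) ^ 2 := by
          refine intervalIntegral.integral_mono_on hst'.le ?_ (by simp) fun r hr => ?_
          · exact (continuousOn_dist_sq (h.cont.mono fun r hr => hs.trans hr.1) y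
              ).intervalIntegrable_of_Icc hst'.le
          · have := ht1 r hr
            gcongr
      _ = _ := by simp
  have hb := ht1 t ⟨hst'.le, le_rfl⟩
  have hab : a - dist (u t) y ≤ K * (t - s) :=
    (by have := dist_triangle (u s) (u t) y; linarith : a - dist (u t) y ≤ dist (u s) (u t)).trans hd
  have hsum : a + dist (u t) y ≤ 2 * (a + η) := by linarith
  have hsq : a ^ 2 / 2 - dist (u t) y ^ 2 / 2 ≤ (t - s) * (K * (a + η)) := by
    have h0 : 0 ≤ a + dist (u t) y := by positivity
    have hK' : 0 ≤ K * (t - s) := mul_nonneg hK (by linarith)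
    calc a ^ 2 / 2 - dist (u t) y ^ 2 / 2 = (a - dist (u t) y) * (a + dist (u t) y) / 2 := by ring
      _ ≤ (K * (t - s)) * (2 * (a + η)) / 2 := by gcongr
      _ = _ := by ring
  have hκ := h.nonneg
  have hint' : κ / 2 * ∫ r in s..t, dist (u r) y ^ 2 ≤ κ / 2 * ((t - s) * (a + η) ^ 2) := by gcongr
  have hfinal : (t - s) * (E (u t)).toReal
      ≤ (t - s) * ((E y).toReal + K * (a + η) + κ / 2 * (a + η) ^ 2) := by
    linarith
  have := le_of_mul_le_mul_left hfinal (by linarith)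
  linarith

theorem slope_le_of_forall (hE : IsAdmissibleEnergy E) {z : X} {K : ℝ} (hz : E z < ⊤)
    (h : ∀ y, E y < ⊤ → (E z).toReal ≤ (E y).toReal + K * dist z y + κ / 2 * dist z y ^ 2) :
    slope E z ≤ ENNReal.ofReal K := by
  rw [slope, if_neg hz.ne]
  have hlim : Tendsto (fun y => ENNReal.ofReal (K + κ / 2 * dist z y)) (𝓝[≠] z)
      (𝓝 (ENNReal.ofReal (K + κ / 2 * dist z z))) :=
    ENNReal.tendsto_ofReal
      ((Continuous.tendsto (by fun_prop) _).mono_left nhdsWithin_le_nhds)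
  rw [dist_self, mul_zero, add_zero] at hlim
  rcases (𝓝[≠] z).eq_or_neBot with hbot | hne
  · simp [hbot]
  rw [← hlim.limsup_eq]
  refine limsup_le_limsup ?_
  filter_upwards [self_mem_nhdsWithin] with y hy
  have hpos : 0 < dist z y := dist_pos.2 (Ne.symm hy)
  by_cases hytop : E y = ⊤
  · simp [hytop, EReal.sub_top]
  have hy' : E y < ⊤ := lt_top_iff_ne_top.2 hytop
  rw [edist_dist]
  refine ENNReal.div_le_of_le_mul ?_
  rw [← hE.coe_toReal hz, ← hE.coe_toReal hy', ← EReal.coe_sub, ← ENNReal.ofReal_mul' hpos.le,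
    EReal.toENNReal_of_ne_top (EReal.coe_ne_top _), EReal.toReal_coe]
  apply ENNReal.ofReal_le_ofReal
  have := h y hy'
  nlinarith

theorem IsDescentCurve.slope_le_of_frequently (hE : IsAdmissibleEnergy E)
    (h : IsDescentCurve E κ u) {s K : ℝ} (hs : 0 ≤ s) (hfin : E (u s) < ⊤) (hK : 0 ≤ K)
    (hfreq : ∃ᶠ t in 𝓝[>] s, dist (u s) (u t) ≤ K * (t - s)) :
    slope E (u s) ≤ ENNReal.ofReal K :=
  slope_le_of_forall hE hfin fun _ hy => h.le_of_frequently_dist_le hE hs hfin hK hfreq hy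

/-- This makes the slope square integrable along flow pieces of finite kinetic energy, including
those started where the slope is infinite. -/
theorem IsDescentCurve.slope_le_metricSpeed (hE : IsAdmissibleEnergy E)
    (h : IsDescentCurve E κ u) {s : ℝ} (hs : 0 < s) : slope E (u s) ≤ metricSpeed u s := by
  refine le_of_forall_gt_imp_ge_of_dense fun L hL => ?_
  rcases eq_or_ne L ⊤ with rfl | hLtop
  · exact le_top
  lift L to NNReal using hLtop
  have h1 : ∀ᶠ t in 𝓝[≠] s, edist (u t) (u s) / edist t s < L := eventually_lt_of_limsup_lt hL
  have h2 : ∀ᶠ t in 𝓝[>] s, dist (u s) (u t) ≤ L * (t - s) := by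
    filter_upwards [h1.filter_mono (nhdsWithin_mono _ fun t (ht : s < t) => ne_of_gt ht),
      self_mem_nhdsWithin] with t ht hst
    have hst' : s < t := hst
    have h3 := ht.le
    rw [ENNReal.div_le_iff (by simpa using hst'.ne') (edist_ne_top _ _), edist_dist, edist_dist,
      ← ENNReal.ofReal_coe_nnreal, ← ENNReal.ofReal_mul L.coe_nonneg,
      ENNReal.ofReal_le_ofReal_iff (by positivity), Real.dist_eq, abs_of_pos (by linarith)] at h3
    rwa [dist_comm]
  have h3 := h.slope_le_of_frequently hE hs.le (h.lt_top s hs) L.coe_nonneg h2.frequently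
  rwa [ENNReal.ofReal_coe_nnreal] at h3

/-- Global bound of energy differences by the slope. -/
theorem IsDescentCurve.toReal_le_of_slope (hE : IsAdmissibleEnergy E)
    (h : IsDescentCurve E κ u) (hsl : slope E (u 0) < ⊤) {y : X} (hy : E y < ⊤) :
    (E (u 0)).toReal ≤ (E y).toReal + 4 * (slope E (u 0)).toReal * dist (u 0) y
      + κ / 2 * dist (u 0) y ^ 2 := by
  have hfin : E (u 0) < ⊤ := by
    by_contra hcon
    rw [not_lt, top_le_iff] at hcon
    simp [slope, hcon] at hsl
  set σ := (slope E (u 0)).toReal with hσ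
  have hσ0 : 0 ≤ σ := ENNReal.toReal_nonneg
  have hlim : Tendsto (fun L : ℝ => (E y).toReal + 4 * L * dist (u 0) y + κ / 2 * dist (u 0) y ^ 2)
      (𝓝[>] σ) (𝓝 ((E y).toReal + 4 * σ * dist (u 0) y + κ / 2 * dist (u 0) y ^ 2)) :=
    (Continuous.tendsto (by fun_prop) _).mono_left nhdsWithin_le_nhds
  refine ge_of_tendsto hlim ?_
  filter_upwards [self_mem_nhdsWithin] with L hL
  have hL' : σ < L := hL
  have hL0 : 0 < L := hσ0.trans_lt hL'
  refine h.le_of_frequently_dist_le hE le_rfl hfin (by positivity) (Eventually.frequently ?_) hy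
  have h1 : slope E (u 0) < ENNReal.ofReal L := by
    rwa [← ENNReal.ofReal_toReal hsl.ne, ENNReal.ofReal_lt_ofReal_iff hL0]
  rw [slope, if_neg hfin.ne] at h1
  have h2 := eventually_nhdsWithin_iff.1 (eventually_lt_of_limsup_lt h1)
  have hcs : Tendsto u (𝓝[>] 0) (𝓝 (u 0)) :=
    (h.cont 0 self_mem_Ici).mono_left (nhdsWithin_mono _ Ioi_subset_Ici_self)
  have hκ := h.nonneg
  have h3 : (0 : ℝ) < 1 / (2 * κ + 1) := by positivity
  filter_upwards [hcs.eventually h2, Ioo_mem_nhdsGT h3] with t ht htI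
  rw [sub_zero]
  by_cases heq : u t = u 0
  · rw [heq, dist_self]; have := htI.1; positivity
  have hpos : 0 < dist (u 0) (u t) := dist_pos.2 (Ne.symm heq)
  have h4 := (ht heq).le
  have htop := h.lt_top t htI.1
  rw [edist_dist, ENNReal.div_le_iff (by simpa using Ne.symm heq) ENNReal.ofReal_ne_top,
    ← hE.coe_toReal hfin, ← hE.coe_toReal htop, ← EReal.coe_sub, ← ENNReal.ofReal_mul hL0.le,
    EReal.toENNReal_of_ne_top (EReal.coe_ne_top _), EReal.toReal_coe,
    ENNReal.ofReal_le_ofReal_iff (by positivity)] at h4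
  have hsmall : κ * (t - 0) ≤ 1 / 2 := by
    have := htI.2.le
    calc κ * (t - 0) ≤ κ * (1 / (2 * κ + 1)) := by gcongr; linarith
      _ ≤ 1 / 2 := by rw [mul_one_div, div_le_div_iff₀ (by positivity) (by norm_num)]; linarith
  have h5 := h.dist_sq_le hE le_rfl htI.1.le hfin hsmall
  -- The squared displacement is at most `4 * t` times the energy drop, and the slope bounds that
  -- drop by `L` times the displacement; cancelling one factor gives speed `4 * L`.
  have h6 : dist (u 0) (u t) * dist (u 0) (u t) ≤ (4 * L * t) * dist (u 0) (u t) := by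
    have := htI.1
    calc dist (u 0) (u t) * dist (u 0) (u t) = dist (u 0) (u t) ^ 2 := by ring
      _ ≤ _ := h5
      _ ≤ 4 * (t - 0) * (L * dist (u 0) (u t)) := by
        rw [sub_zero]; gcongr
      _ = _ := by ring
  exact le_of_mul_le_mul_right h6 hpos

/-- Descent curves contract distances, up to an exponential factor. -/
theorem IsDescentCurve.dist_sq_le_exp_of_pos (hE : IsAdmissibleEnergy E)
    (hu : IsDescentCurve E κ u) (hv : IsDescentCurve E κ v) {a b : ℝ} (ha : 0 < a) (hab : a ≤ b) :
    dist (u b) (v b) ^ 2 ≤ dist (u a) (v a) ^ 2 * Real.exp (2 * κ * (b - a)) := by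
  have hcont : ContinuousOn (fun t => dist (u t) (v t) ^ 2) (Ici 0) :=
    (continuous_dist.comp_continuousOn (hu.cont.prodMk hv.cont)).pow 2
  have key := le_gronwallBound_of_liminf_deriv_right_le (f := fun t => dist (u t) (v t) ^ 2)
    (f' := fun t => 2 * κ * dist (u t) (v t) ^ 2) (δ := dist (u a) (v a) ^ 2) (K := 2 * κ) (ε := 0)
    (a := a) (b := b) (hcont.mono fun r hr => ha.le.trans hr.1) ?_ le_rfl
    (fun _ _ => by simp) b ⟨hab, le_rfl⟩
  · rwa [gronwallBound_ε0] at key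
  intro s hs r hr
  have hs0 : 0 < s := ha.trans_le hs.1
  set φ := dist (u s) (v s) ^ 2 with hφ
  have hκ := hu.nonneg
  obtain ⟨η, hη, hηr⟩ : ∃ η > 0, 2 * η + 2 * κ * (φ + η) < r := by
    have hlim : Tendsto (fun η : ℝ => 2 * η + 2 * κ * (φ + η)) (𝓝[>] 0)
        (𝓝 (2 * 0 + 2 * κ * (φ + 0))) :=
      (Continuous.tendsto (by fun_prop) _).mono_left nhdsWithin_le_nhds
    have := (hlim.eventually (gt_mem_nhds (by simpa using hr))).and self_mem_nhdsWithin
    obtain ⟨η, h1, h2⟩ := this.exists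
    exact ⟨η, h2, h1⟩
  have hcu : ContinuousAt u s := hu.cont.continuousAt (Ici_mem_nhds hs0)
  have hcv : ContinuousAt v s := hv.cont.continuousAt (Ici_mem_nhds hs0)
  have e1 : ∀ᶠ p : ℝ × ℝ in 𝓝 s ×ˢ 𝓝 s, dist (u p.1) (v p.2) ^ 2 < φ + η := by
    have h1 : Tendsto (fun p : ℝ × ℝ => dist (u p.1) (v p.2) ^ 2) (𝓝 s ×ˢ 𝓝 s) (𝓝 φ) :=
      ((hcu.tendsto.comp tendsto_fst).dist (hcv.tendsto.comp tendsto_snd)).pow 2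
    exact h1.eventually (gt_mem_nhds (by linarith))
  obtain ⟨p, hp, q, hq, hpq⟩ := eventually_prod_iff.1 e1
  have e2 : ∀ᶠ t in 𝓝[>] s, ∀ r ∈ Icc s t, p r ∧ q r :=
    eventually_forall_Icc ((hp.and hq).filter_mono nhdsWithin_le_nhds)
  have e3 : ∀ᶠ t in 𝓝[>] s, E (v t) < ⊤ → (E (v s)).toReal - η < (E (v t)).toReal :=
    (hcv.tendsto.mono_left nhdsWithin_le_nhds).eventually
      (hE.eventually_lt_toReal (hv.lt_top s hs0) (by linarith))
  refine Eventually.frequently ?_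
  filter_upwards [e2, e3, self_mem_nhdsWithin] with t h2 h3 hst
  have hst' : s < t := hst
  have ht0 : 0 < t := hs0.trans hst'
  -- Testing `u` against `v s` and `v` against `u t` makes both `E (u t)` and the mixed distance
  -- cancel on adding; only `E (v s) - E (v t)` remains, for which lower semicontinuity suffices.
  have w1 := hu.weak (v s) (hv.lt_top s hs0) s t hs0.le hst'.le ht0
  have w2 := hv.weak (u t) (hu.lt_top t ht0) s t hs0.le hst'.le ht0
  have i1 : ∫ r in s..t, dist (u r) (v s) ^ 2 ≤ (t - s) * (φ + η) := by
    calc ∫ r in s..t, dist (u r) (v s) ^ 2 ≤ ∫ _ in s..t, (φ + η) := by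
          refine intervalIntegral.integral_mono_on hst'.le ?_ (by simp) fun r hr => ?_
          · exact (continuousOn_dist_sq (hu.cont.mono fun r hr => hs0.le.trans hr.1) _
              ).intervalIntegrable_of_Icc hst'.le
          · exact (hpq (h2 r hr).1 (h2 s ⟨le_rfl, hst'.le⟩).2).le
      _ = _ := by rw [intervalIntegral.integral_const, smul_eq_mul]
  have i2 : ∫ r in s..t, dist (v r) (u t) ^ 2 ≤ (t - s) * (φ + η) := by
    calc ∫ r in s..t, dist (v r) (u t) ^ 2 ≤ ∫ _ in s..t, (φ + η) := by
          refine intervalIntegral.integral_mono_on hst'.le ?_ (by simp) fun r hr => ?_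
          · exact (continuousOn_dist_sq (hv.cont.mono fun r hr => hs0.le.trans hr.1) _
              ).intervalIntegrable_of_Icc hst'.le
          · rw [dist_comm]
            exact (hpq (h2 t ⟨hst'.le, le_rfl⟩).1 (h2 r hr).2).le
      _ = _ := by rw [intervalIntegral.integral_const, smul_eq_mul]
  have i1' : κ / 2 * ∫ r in s..t, dist (u r) (v s) ^ 2 ≤ κ / 2 * ((t - s) * (φ + η)) := by gcongr
  have i2' : κ / 2 * ∫ r in s..t, dist (v r) (u t) ^ 2 ≤ κ / 2 * ((t - s) * (φ + η)) := by gcongr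
  have h4 := h3 (hv.lt_top t ht0)
  rw [dist_comm (v t) (u t), dist_comm (v s) (u t)] at w2
  rw [inv_mul_lt_iff₀ (by linarith)]
  have h5 : (t - s) * ((E (v s)).toReal - (E (v t)).toReal) ≤ (t - s) * η := by
    gcongr
    linarith
  have h6 : (t - s) * (2 * η + 2 * κ * (φ + η)) < (t - s) * r := by
    gcongr
  linarith

/-- Time `0` is added by continuity, because the starting points may have infinite energy and cannot
serve as test points. -/
theorem IsDescentCurve.dist_sq_le_exp (hE : IsAdmissibleEnergy E)
    (hu : IsDescentCurve E κ u) (hv : IsDescentCurve E κ v) {a b : ℝ} (ha : 0 ≤ a) (hab : a ≤ b) :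
    dist (u b) (v b) ^ 2 ≤ dist (u a) (v a) ^ 2 * Real.exp (2 * κ * (b - a)) := by
  rcases ha.eq_or_lt with rfl | ha'
  swap
  · exact hu.dist_sq_le_exp_of_pos hE hv ha' hab
  rcases hab.eq_or_lt with rfl | hb
  · simp
  have hcont : ContinuousWithinAt (fun t => dist (u t) (v t) ^ 2 * Real.exp (2 * κ * (b - t)))
      (Ici 0) 0 := by
    have h1 := (continuous_dist.comp_continuousOn (hu.cont.prodMk hv.cont)).pow 2
    exact (h1 0 self_mem_Ici).mul (Continuous.continuousWithinAt (by fun_prop))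
  refine ge_of_tendsto (hcont.mono_left (nhdsWithin_mono _ Ioi_subset_Ici_self)) ?_
  filter_upwards [Ioo_mem_nhdsGT hb] with t ht
  exact hu.dist_sq_le_exp_of_pos hE hv ht.1 ht.2.le

theorem IsDescentCurve.shift (h : IsDescentCurve E κ u) {τ : ℝ} (hτ : 0 ≤ τ) :
    IsDescentCurve E κ (fun t => u (t + τ)) where
  nonneg := h.nonneg
  cont := h.cont.comp (by fun_prop) fun t ht => by
    have : (0 : ℝ) ≤ t := ht
    exact mem_Ici.2 (by positivity)
  lt_top t ht := h.lt_top _ (by linarith)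
  anti s t hs hst := h.anti _ _ (by linarith) (by linarith)
  weak y hy s t hs hst ht := by
    have := h.weak y hy (s + τ) (t + τ) (by linarith) (by linarith) (by linarith)
    rw [intervalIntegral.integral_comp_add_right (fun r => dist (u r) y ^ 2)]
    rwa [add_sub_add_right_eq_sub] at this

/-- Regularisation: the slope at time `h` is controlled by the dissipation on `[h / 2, h]`. -/
theorem IsDescentCurve.slope_le_sqrt (hE : IsAdmissibleEnergy E) (h : IsDescentCurve E κ u)
    {τ : ℝ} (hτ : 0 < τ) (hsmall : κ * τ ≤ 1 / 2) :
    slope E (u τ) ≤ ENNReal.ofReal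
      √(128 * ((E (u (τ / 2))).toReal - (E (u τ)).toReal) / τ) := by
  have hκ := h.nonneg
  set D := (E (u (τ / 2))).toReal - (E (u τ)).toReal with hD
  refine h.slope_le_of_frequently hE hτ.le (h.lt_top τ hτ) (Real.sqrt_nonneg _) ?_
  have hstep : ∀ n : ℕ, 0 < n → dist (u τ) (u (τ + τ / 2 / n))
      ≤ √(128 * D / τ) * (τ + τ / 2 / n - τ) := by
    intro n hn
    have hn' : (1 : ℝ) ≤ n := by exact_mod_cast hn
    set δ := τ / 2 / n with hδ
    have hδ0 : 0 < δ := by positivity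
    have hδτ : δ ≤ τ / 2 := div_le_self (by positivity) hn'
    have hnδ : n * δ = τ / 2 := by rw [hδ]; field_simp
    -- Contraction compares the increment at `τ` with the one at each earlier grid time, at the
    -- price of a factor 4, and dissipation bounds the latter. The sum over `i` telescopes to `n *
    -- d² ≤ 16 * δ * D`; with `n * δ = τ / 2` this gives `d² ≤ 32 * δ² * D / τ`.
    have hterm : ∀ i ∈ Finset.range n, dist (u τ) (u (τ + δ)) ^ 2
        ≤ 16 * δ * ((E (u (τ / 2 + i * δ))).toReal
          - (E (u (τ / 2 + (i + 1 : ℕ) * δ))).toReal) := by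
      intro i hi
      have hi' : (i : ℝ) + 1 ≤ n := by exact_mod_cast Finset.mem_range.1 hi
      have hiδ : i * δ + δ ≤ τ / 2 := by
        rw [← hnδ]
        calc i * δ + δ = (i + 1) * δ := by ring
          _ ≤ n * δ := by gcongr
      have hi0 : 0 ≤ i * δ := by positivity
      set s := τ / 2 + i * δ with hs
      have hs0 : 0 < s := by linarith
      have h1 := h.dist_sq_le_exp hE (h.shift hδ0.le) hs0.le (show s ≤ τ by linarith)
      have h2 := h.dist_sq_le hE hs0.le (show s ≤ s + δ by linarith) (h.lt_top s hs0)
        (by rw [add_sub_cancel_left]; refine le_trans ?_ hsmall; gcongr; linarith)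
      rw [add_sub_cancel_left] at h2
      have hexp : Real.exp (2 * κ * (τ - s)) ≤ 4 := by
        have h3 : 2 * κ * (τ - s) ≤ 1 / 2 := by
          have : κ * (τ - s) ≤ κ * (τ / 2) := by gcongr; linarith
          linarith
        calc Real.exp (2 * κ * (τ - s)) ≤ Real.exp 1 := Real.exp_le_exp.2 (by linarith)
          _ ≤ 4 := by linarith [Real.exp_one_lt_d9]
      have hcast : τ / 2 + ((i + 1 : ℕ) : ℝ) * δ = s + δ := by push_cast; ring
      rw [hcast]
      calc dist (u τ) (u (τ + δ)) ^ 2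
          ≤ dist (u s) (u (s + δ)) ^ 2 * Real.exp (2 * κ * (τ - s)) := h1
        _ ≤ dist (u s) (u (s + δ)) ^ 2 * 4 := by gcongr
        _ ≤ (4 * δ * ((E (u s)).toReal - (E (u (s + δ))).toReal)) * 4 := by gcongr
        _ = _ := by ring
    have hsum := Finset.sum_le_sum hterm
    rw [← Finset.mul_sum, Finset.sum_range_sub' (fun i : ℕ => (E (u (τ / 2 + i * δ))).toReal)] at hsum
    simp only [Finset.sum_const, Finset.card_range, nsmul_eq_mul, Nat.cast_zero, zero_mul,
      add_zero, hnδ, add_halves] at hsum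
    have hDnn : 0 ≤ D := by
      have := h.toReal_anti hE (show 0 ≤ τ / 2 by linarith) (show τ / 2 ≤ τ by linarith)
        (h.lt_top _ (by linarith))
      linarith
    rw [add_sub_cancel_left]
    refine abs_le_of_sq_le_sq' ?_ (by positivity) |>.2
    rw [mul_pow, Real.sq_sqrt (by positivity)]
    have h5 : (n * δ) * dist (u τ) (u (τ + δ)) ^ 2 ≤ 16 * δ ^ 2 * D := by
      calc (n * δ) * dist (u τ) (u (τ + δ)) ^ 2 = δ * (n * dist (u τ) (u (τ + δ)) ^ 2) := by ring
        _ ≤ δ * (16 * δ * D) := by gcongr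
        _ = _ := by ring
    rw [hnδ] at h5
    rw [div_mul_eq_mul_div, le_div_iff₀ hτ]
    nlinarith [mul_nonneg (sq_nonneg δ) hDnn]
  have htend : Tendsto (fun n : ℕ => τ + τ / 2 / n) atTop (𝓝[>] τ) := by
    refine tendsto_nhdsWithin_iff.2 ⟨?_, ?_⟩
    · simpa using (tendsto_const_div_atTop_nhds_zero_nat (τ / 2)).const_add τ
    · filter_upwards [eventually_gt_atTop 0] with n hn
      have : (0 : ℝ) < n := by exact_mod_cast hn
      exact mem_Ioi.2 (lt_add_of_pos_right _ (by positivity))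
  refine htend.frequently (Eventually.frequently ?_)
  filter_upwards [eventually_gt_atTop 0] with n hn using hstep n hn

/-- The slope at a positive time is bounded uniformly over bounded sets of starting points. -/
theorem IsDescentCurve.exists_slope_le (hE : IsAdmissibleEnergy E) (hv : IsDescentCurve E κ v)
    (hfin : E (v 0) < ⊤) {τ : ℝ} (hτ : 0 < τ) (hsmall : κ * τ ≤ 1 / 2) (R : ℝ) :
    ∃ K : ℝ, ∀ u, IsDescentCurve E κ u → dist (u 0) (v 0) ≤ R →
      slope E (u τ) ≤ ENNReal.ofReal K := by
  have hκ := hv.nonneg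
  obtain ⟨ρ, hρ⟩ := (isCompact_Icc.image_of_continuousOn
    (hv.cont.mono fun r (hr : r ∈ Icc 0 τ) => hr.1)).isBounded.subset_closedBall (v 0)
  -- Radius of a ball around `v 0` containing every such `u` up to time `τ`: contraction gives `2 *
  -- |R|` for the distance to `v`, and `ρ` bounds the excursion of `v`. Below, `M` bounds the energy
  -- drop on `[τ / 2, τ]`.
  set B := 2 * |R| + |ρ| with hB
  obtain ⟨c, hc⟩ := hE.bddBelow (Metric.closedBall (v 0) B) Metric.isBounded_closedBall
  set M := B ^ 2 / τ + (E (v 0)).toReal + κ / 2 * B ^ 2 - c with hM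
  refine ⟨√(128 * M / τ), fun u hu hdist => (hu.slope_le_sqrt hE hτ hsmall).trans ?_⟩
  have hball : ∀ r ∈ Icc 0 τ, dist (u r) (v 0) ≤ B := by
    intro r hr
    have h1 := hu.dist_sq_le_exp hE hv le_rfl hr.1
    have hexp : Real.exp (2 * κ * (r - 0)) ≤ 2 ^ 2 := by
      have h3 : 2 * κ * (r - 0) ≤ 1 := by
        have : κ * r ≤ κ * τ := by have := hr.2; gcongr
        linarith
      calc Real.exp (2 * κ * (r - 0)) ≤ Real.exp 1 := Real.exp_le_exp.2 h3
        _ ≤ 2 ^ 2 := by linarith [Real.exp_one_lt_d9]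
    have h2 : dist (u r) (v r) ≤ 2 * |R| := by
      refine abs_le_of_sq_le_sq' ?_ (by positivity) |>.2
      calc dist (u r) (v r) ^ 2 ≤ dist (u 0) (v 0) ^ 2 * 2 ^ 2 := h1.trans (by gcongr)
        _ ≤ |R| ^ 2 * 2 ^ 2 := by gcongr; exact hdist.trans (le_abs_self R)
        _ = _ := by ring
    have h3 : dist (v r) (v 0) ≤ |ρ| := (hρ (mem_image_of_mem v hr)).trans (le_abs_self ρ)
    exact (dist_triangle _ (v r) _).trans (add_le_add h2 h3)
  have hlow : c ≤ (E (u τ)).toReal := by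
    have := hc (u τ) (hball τ ⟨hτ.le, le_rfl⟩)
    rw [← hE.coe_toReal (hu.lt_top τ hτ)] at this
    exact_mod_cast this
  have hw := hu.weak (v 0) hfin 0 (τ / 2) le_rfl (by linarith) (by linarith)
  have hint : ∫ r in (0 : ℝ)..(τ / 2), dist (u r) (v 0) ^ 2 ≤ (τ / 2) * B ^ 2 := by
    calc ∫ r in (0 : ℝ)..(τ / 2), dist (u r) (v 0) ^ 2 ≤ ∫ _ in (0 : ℝ)..(τ / 2), B ^ 2 := by
          refine intervalIntegral.integral_mono_on (by linarith) ?_ (by simp) fun r hr => ?_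
          · exact (continuousOn_dist_sq (hu.cont.mono fun r hr => hr.1) _
              ).intervalIntegrable_of_Icc (by linarith)
          · have := hball r ⟨hr.1, by have := hr.2; linarith⟩
            gcongr
      _ = _ := by simp
  have hint' : κ / 2 * ∫ r in (0 : ℝ)..(τ / 2), dist (u r) (v 0) ^ 2
      ≤ κ / 2 * ((τ / 2) * B ^ 2) := by gcongr
  have h0 : dist (u 0) (v 0) ^ 2 ≤ B ^ 2 := by
    have := hball 0 ⟨le_rfl, hτ.le⟩
    gcongr
  have hup : (E (u (τ / 2))).toReal ≤ B ^ 2 / τ + (E (v 0)).toReal + κ / 2 * B ^ 2 := by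
    have h4 : τ / 2 * (E (u (τ / 2))).toReal
        ≤ τ / 2 * (B ^ 2 / τ + (E (v 0)).toReal + κ / 2 * B ^ 2) := by
      have h5 : τ / 2 * (B ^ 2 / τ) = B ^ 2 / 2 := by field_simp
      have h6 : 0 ≤ dist (u (τ / 2)) (v 0) ^ 2 := by positivity
      rw [sub_zero] at hw
      linarith
    exact le_of_mul_le_mul_left h4 (by linarith)
  apply ENNReal.ofReal_le_ofReal
  apply Real.sqrt_le_sqrt
  gcongr
  linarith

end Descent

/-! ### Finite energy at the endpoints and smoothing of curves by the flow. -/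

section Regularisation

variable {X : Type*} [MetricSpace X] {E : X → EReal}

theorem IsAdmissibleEnergy.exists_descent (hE : IsAdmissibleEnergy E) :
    ∃ κ : ℝ, ∃ S : X → ℝ → X, 0 ≤ κ ∧ ∀ z, S z 0 = z ∧ IsDescentCurve E κ (S z) := by
  obtain ⟨lam, hflow⟩ := hE.flow
  have h1 : ∀ z, ∃ u : ℝ → X, u 0 = z ∧ IsDescentCurve E |lam| u := fun z => by
    obtain ⟨γ, hγ⟩ := hflow z
    exact hγ.exists_isDescentCurve hE
  choose S hS using h1
  exact ⟨|lam|, S, abs_nonneg _, hS⟩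

theorem lt_top_of_slope_lt_top {z : X} (h : slope E z < ⊤) : E z < ⊤ := by
  by_contra hcon
  rw [not_lt, top_le_iff] at hcon
  simp [slope, hcon] at h

/-- If every value exceeded the mean by at least one, the integral would exceed itself. The slack `b
- a` makes this strict and avoids any measurability of `f`. -/
theorem exists_mul_le_of_lintegral_lt_top {f : ℝ → ℝ≥0∞} {a b : ℝ} (hab : a < b)
    (h : ∫⁻ t in Ioo a b, f t < ⊤) :
    ∃ s ∈ Ioo a b, f s < ⊤ ∧
      (f s).toReal * (b - a) ≤ (∫⁻ t in Ioo a b, f t).toReal + (b - a) := by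
  by_contra! hcon
  set I := ∫⁻ t in Ioo a b, f t with hI
  have hpos : 0 < b - a := sub_pos.2 hab
  have hle : ∀ t ∈ Ioo a b, ENNReal.ofReal (I.toReal / (b - a) + 1) ≤ f t := by
    intro t ht
    by_cases hft : f t = ⊤
    · rw [hft]; exact le_top
    rw [ENNReal.ofReal_le_iff_le_toReal hft]
    have := hcon t ht (lt_top_iff_ne_top.2 hft)
    have h3 : I.toReal / (b - a) + 1 = (I.toReal + (b - a)) / (b - a) := by field_simp
    rw [h3, div_le_iff₀ hpos]
    exact this.le
  have h2 : ENNReal.ofReal (I.toReal + (b - a)) ≤ I := by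
    calc ENNReal.ofReal (I.toReal + (b - a))
        = ∫⁻ _ in Ioo a b, ENNReal.ofReal (I.toReal / (b - a) + 1) := by
          rw [setLIntegral_const, Real.volume_Ioo, ← ENNReal.ofReal_mul (by positivity)]
          congr 1
          field_simp
      _ ≤ I := setLIntegral_mono' measurableSet_Ioo hle
  rw [ENNReal.ofReal_le_iff_le_toReal h.ne] at h2
  linarith

/-- A curve of finite energy with square integrable slope starts in the domain of `E`. -/
theorem lt_top_of_lintegral_slope_sq (hE : IsAdmissibleEnergy E) {ω : ℝ → X} {e : ℝ → ℝ}
    (hω : HasEnergyBound ω e 0 1) (hI : ∫⁻ t in Ioo (0 : ℝ) 1, slope E (ω t) ^ 2 < ⊤) :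
    E (ω 0) < ⊤ := by
  obtain ⟨κ, S, hκ, hS⟩ := hE.exists_descent
  set τ : ℕ → ℝ := fun k => (1 / 2) ^ (k + 1) with hτdef
  have hτ0 : ∀ k, 0 < τ k := fun k => by positivity
  have hτs : ∀ k, τ (k + 1) = τ k / 2 := fun k => by simp only [hτdef]; ring
  have hτ1 : ∀ k, τ k ≤ 1 / 2 := fun k => by
    simp only [hτdef, pow_succ]
    have : (1 / 2 : ℝ) ^ k ≤ 1 := pow_le_one₀ (by norm_num) (by norm_num)
    linarith
  have hfin : ∀ a b, 0 ≤ a → b ≤ 1 → ∫⁻ t in Ioo a b, slope E (ω t) ^ 2 < ⊤ := fun a b ha hb =>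
    (lintegral_mono_set (Ioo_subset_Ioo ha hb)).trans_lt hI
  set Q : ℝ → ℝ := fun t => (∫⁻ r in Ioo 0 t, slope E (ω r) ^ 2).toReal with hQ
  have hQadd : ∀ a b, 0 ≤ a → a ≤ b → b ≤ 1 →
      (∫⁻ t in Ioo a b, slope E (ω t) ^ 2).toReal = Q b - Q a := by
    intro a b ha hab hb
    have hsplit : ∫⁻ r in Ioo 0 b, slope E (ω r) ^ 2
        = (∫⁻ r in Ioo 0 a, slope E (ω r) ^ 2) + ∫⁻ r in Ioo a b, slope E (ω r) ^ 2 := by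
      rw [restrict_Ioo_eq_restrict_Ioc, ← Ioc_union_Ioc_eq_Ioc ha hab,
        lintegral_union measurableSet_Ioc (Ioc_disjoint_Ioc_of_le le_rfl),
        ← restrict_Ioo_eq_restrict_Ioc, ← restrict_Ioo_eq_restrict_Ioc]
    simp only [hQ]
    rw [hsplit, ENNReal.toReal_add (hfin _ _ le_rfl (hab.trans hb)).ne (hfin _ _ ha hb).ne,
      add_sub_cancel_left]
  have hchoice : ∀ k, ∃ s ∈ Ioo (τ k) (2 * τ k), slope E (ω s) ^ 2 < ⊤ ∧
      (slope E (ω s) ^ 2).toReal * τ k ≤ Q (2 * τ k) - Q (τ k) + τ k := by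
    intro k
    have h1 := hτ0 k
    have h2 := hτ1 k
    obtain ⟨s, hs, hs1, hs2⟩ := exists_mul_le_of_lintegral_lt_top (show τ k < 2 * τ k by linarith)
      (hfin (τ k) (2 * τ k) h1.le (by linarith))
    rw [hQadd _ _ h1.le (by linarith) (by linarith)] at hs2
    refine ⟨s, hs, hs1, ?_⟩
    have h3 : 2 * τ k - τ k = τ k := by ring
    rwa [h3] at hs2
  choose s hs hsl hsQ using hchoice
  have hsl' : ∀ k, slope E (ω (s k)) < ⊤ := fun k => by
    by_contra hcon
    rw [not_lt, top_le_iff] at hcon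
    have := hsl k
    simp [hcon] at this
  have hEs : ∀ k, E (ω (s k)) < ⊤ := fun k => lt_top_of_slope_lt_top (hsl' k)
  -- The global slope bound at `ω (s (k + 1))` controls the energy change between consecutive sample
  -- times by `4 * σ * d + κ / 2 * d²`. Young's inequality splits this into slope and kinetic parts,
  -- which the three correction terms telescope. Thus `Φ` is nonincreasing, the sampled energies
  -- stay bounded, and lower semicontinuity concludes at time `0`.
  set Φ : ℕ → ℝ := fun k => (E (ω (s k))).toReal + 2 * Q (τ k) + 2 * τ k
    + (8 + 2 * κ) * (e (s k) - e 0) with hΦ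
  have hstep : ∀ k, Φ (k + 1) ≤ Φ k := by
    intro k
    set t := τ (k + 1) with ht
    have htk : τ k = 2 * t := by rw [ht, hτs]; ring
    have ht0 : 0 < t := hτ0 _
    have hs1 := hs (k + 1)
    have hs0 := hs k
    rw [htk] at hs0
    have ht1 : t ≤ 1 / 4 := by have := hτ1 k; rw [htk] at this; linarith
    have hd := hω (s (k + 1)) (s k) (by linarith [hs1.1]) (by linarith [hs1.2, hs0.1])
      (by linarith [hs0.2])
    have hmono : e (s (k + 1)) ≤ e (s k) := hω.monotoneOn
      ⟨by linarith [hs1.1], by linarith [hs1.2]⟩ ⟨by linarith [hs0.1], by linarith [hs0.2]⟩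
      (by linarith [hs1.2, hs0.1])
    set d := dist (ω (s (k + 1))) (ω (s k)) with hddef
    set σ := (slope E (ω (s (k + 1)))).toReal with hσ
    have hd' : d ^ 2 ≤ 4 * t * (e (s k) - e (s (k + 1))) := by
      refine hd.trans ?_
      gcongr
      linarith [hs0.2, hs1.1]
    have hσQ : σ ^ 2 * t ≤ Q (2 * t) - Q t + t := by
      have := hsQ (k + 1)
      rwa [ENNReal.toReal_pow] at this
    obtain ⟨hu0, hu⟩ := hS (ω (s (k + 1)))
    have hglob := hu.toReal_le_of_slope hE (by rw [hu0]; exact hsl' _) (hEs k)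
    rw [hu0] at hglob
    have hyoung : 4 * σ * d ≤ 2 * (σ ^ 2 * t) + 8 * (e (s k) - e (s (k + 1))) := by
      have h1 : 4 * σ * d * t ≤ (2 * (σ ^ 2 * t) + 8 * (e (s k) - e (s (k + 1)))) * t := by
        nlinarith [sq_nonneg (σ * t - d)]
      exact le_of_mul_le_mul_right h1 ht0
    have hdd : κ / 2 * d ^ 2 ≤ 2 * κ * (e (s k) - e (s (k + 1))) := by
      have h1 : d ^ 2 ≤ 4 * (e (s k) - e (s (k + 1))) := by
        refine hd'.trans ?_
        have : 0 ≤ e (s k) - e (s (k + 1)) := by linarith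
        nlinarith
      calc κ / 2 * d ^ 2 ≤ κ / 2 * (4 * (e (s k) - e (s (k + 1)))) := by gcongr
        _ = _ := by ring
    simp only [hΦ, htk]
    rw [← ht]
    nlinarith
  have hanti : ∀ k, Φ k ≤ Φ 0 := fun k => antitone_nat_of_succ_le hstep (Nat.zero_le k)
  have hbound : ∀ k, E (ω (s k)) ≤ (Φ 0 : ℝ) := by
    intro k
    rw [← hE.coe_toReal (hEs k)]
    have h1 := hanti k
    have h2 : 0 ≤ Q (τ k) := ENNReal.toReal_nonneg
    have h3 := hτ0 k
    have h4 : e 0 ≤ e (s k) := hω.monotoneOn ⟨le_rfl, zero_le_one⟩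
      ⟨by linarith [(hs k).1], by linarith [(hs k).2, hτ1 k]⟩ (by linarith [(hs k).1])
    have h5 : 0 ≤ (8 + 2 * κ) * (e (s k) - e 0) := mul_nonneg (by positivity) (by linarith)
    have h6 : (E (ω (s k))).toReal ≤ Φ 0 := by
      have : Φ k = (E (ω (s k))).toReal + 2 * Q (τ k) + 2 * τ k
        + (8 + 2 * κ) * (e (s k) - e 0) := rfl
      linarith
    exact_mod_cast h6
  have hτlim : Tendsto τ atTop (𝓝 0) :=
    (tendsto_pow_atTop_nhds_zero_of_lt_one (by norm_num) (by norm_num)).comp (tendsto_add_atTop_nat 1)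
  have hslim : Tendsto s atTop (𝓝[Icc 0 1] 0) := by
    refine tendsto_nhdsWithin_iff.2 ⟨?_, ?_⟩
    · refine squeeze_zero (fun k => ((hτ0 k).trans (hs k).1).le) (fun k => (hs k).2.le) ?_
      simpa using hτlim.const_mul 2
    · exact Eventually.of_forall fun k =>
        ⟨by linarith [(hs k).1, hτ0 k], by linarith [(hs k).2, hτ1 k]⟩
  have hωlim : Tendsto (fun k => ω (s k)) atTop (𝓝 (ω 0)) :=
    (hω.continuousOn zero_le_one 0 ⟨le_rfl, zero_le_one⟩).tendsto.comp hslim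
  have hmem : ω 0 ∈ E ⁻¹' Iic ((Φ 0 : ℝ) : EReal) :=
    (hE.lsc.isClosed_preimage _).mem_of_tendsto hωlim (Eventually.of_forall hbound)
  exact (mem_Iic.1 hmem).trans_lt (EReal.coe_lt_top _)

theorem HasEnergyBound.reverse {γ : ℝ → X} {e : ℝ → ℝ} {a b c : ℝ} (h : HasEnergyBound γ e a b) :
    HasEnergyBound (fun t => γ (c - t)) (fun t => -e (c - t)) (c - b) (c - a) := by
  intro s t hs hst ht
  have := h (c - t) (c - s) (by linarith) (by linarith) (by linarith)
  rw [dist_comm]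
  refine this.trans (le_of_eq (by ring))

theorem lintegral_Ioo_comp_one_sub (f : ℝ → ℝ≥0∞) :
    ∫⁻ t in Ioo (0 : ℝ) 1, f (1 - t) = ∫⁻ t in Ioo (0 : ℝ) 1, f t := by
  have h1 : MeasurePreserving (fun t : ℝ => 1 - t) := Measure.measurePreserving_sub_left volume 1
  have h2 := h1.setLIntegral_comp_preimage_emb (Homeomorph.subLeft (1 : ℝ)).measurableEmbedding f
    (Ioo 0 1)
  have h3 : (fun t : ℝ => 1 - t) ⁻¹' Ioo 0 1 = Ioo 0 1 := by simp
  rw [h3] at h2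
  exact h2

theorem lt_top_and_lt_top_of_fisher (hE : IsAdmissibleEnergy E) {ω : ℝ → X} (hω : IsAC2 ω)
    (hI : fisher E ω < ⊤) : E (ω 0) < ⊤ ∧ E (ω 1) < ⊤ := by
  have hI' : ∫⁻ t in Ioo (0 : ℝ) 1, slope E (ω t) ^ 2 < ⊤ := by
    by_contra hcon
    rw [not_lt, top_le_iff] at hcon
    simp [fisher, hcon] at hI
  refine ⟨lt_top_of_lintegral_slope_sq hE hω.hasEnergyBound hI', ?_⟩
  have h1 := hω.hasEnergyBound.reverse (c := 1)
  rw [sub_self, sub_zero] at h1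
  have h2 := lt_top_of_lintegral_slope_sq hE h1
    (by rwa [lintegral_Ioo_comp_one_sub (fun t => slope E (ω t) ^ 2)])
  simpa using h2

/-- Gluing of two curves with energy bounds. -/
theorem HasEnergyBound.glue {γ₁ γ₂ : ℝ → X} {e₁ e₂ : ℝ → ℝ} {a b c : ℝ} (hab : a ≤ b) (hbc : b < c)
    (h₁ : HasEnergyBound γ₁ e₁ a b) (h₂ : HasEnergyBound γ₂ e₂ b c) (hb : γ₁ b = γ₂ b) :
    ∃ e, HasEnergyBound (fun t => if t ≤ b then γ₁ t else γ₂ t) e a c ∧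
      e c - e a = (e₁ b - e₁ a) + (e₂ c - e₂ b) := by
  refine ⟨fun t => if t ≤ b then e₁ t else e₂ t - e₂ b + e₁ b, ?_, ?_⟩
  · refine HasEnergyBound.union (b := b) ?_ ?_
    · intro s t hs hst ht
      simp only [if_pos (hst.trans ht), if_pos ht]
      exact h₁ s t hs hst ht
    · intro s t hs hst ht
      have hγ : ∀ r, b ≤ r → (if r ≤ b then γ₁ r else γ₂ r) = γ₂ r := by
        intro r hr
        rcases hr.eq_or_lt with rfl | hr
        · simp [hb]
        · rw [if_neg (not_le.2 hr)]
      have he : ∀ r, b ≤ r → (if r ≤ b then e₁ r else e₂ r - e₂ b + e₁ b)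
          = e₂ r - e₂ b + e₁ b := by
        intro r hr
        rcases hr.eq_or_lt with rfl | hr
        · simp
        · rw [if_neg (not_le.2 hr)]
      simp only [hγ s hs, hγ t (hs.trans hst), he s hs, he t (hs.trans hst)]
      refine (h₂ s t hs hst ht).trans (le_of_eq (by ring))
  · simp only [if_neg (not_le.2 hbc), if_pos hab]
    ring

theorem metricSpeed_congr {γ γ' : ℝ → X} {t : ℝ} (h : γ =ᶠ[𝓝 t] γ') :
    metricSpeed γ t = metricSpeed γ' t := by
  refine limsup_congr ?_
  filter_upwards [h.filter_mono nhdsWithin_le_nhds] with s hs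
  rw [hs, h.self_of_nhds]

theorem metricSpeed_comp_one_sub (γ : ℝ → X) (t : ℝ) :
    metricSpeed (fun s => γ (1 - s)) t = metricSpeed γ (1 - t) := by
  have h1 := (Homeomorph.subLeft (1 : ℝ)).map_punctured_nhds_eq t
  simp only [Homeomorph.subLeft_apply] at h1
  rw [metricSpeed, metricSpeed, ← h1]
  simp only [limsup, limsSup, Filter.eventually_map, Homeomorph.subLeft_apply]
  simp [edist_sub_left]

theorem IsDescentCurve.hasEnergyBound (hE : IsAdmissibleEnergy E) {κ : ℝ} {u : ℝ → X}
    (h : IsDescentCurve E κ u) (hfin : E (u 0) < ⊤) {τ : ℝ} (hsmall : κ * τ ≤ 1 / 2) :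
    HasEnergyBound u (fun t => -4 * (E (u t)).toReal) 0 τ := by
  intro s t hs hst ht
  have hκ := h.nonneg
  have h1 := h.dist_sq_le hE hs hst ((h.anti 0 s le_rfl hs).trans_lt hfin)
    (le_trans (by gcongr; linarith) hsmall)
  refine h1.trans (le_of_eq (by ring))

/-- The curve obtained by following the flow from `γ 0` during time `τ`, then the flow at time `τ`
of the rescaled curve `γ`, and finally the reversed flow from `γ 1`. -/
noncomputable def regularised (S : X → ℝ → X) (γ : ℝ → X) (τ : ℝ) (t : ℝ) : X :=
  if t ≤ 1 - τ then (if t ≤ τ then S (γ 0) t else S (γ ((t - τ) / (1 - 2 * τ))) τ)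
  else S (γ 1) (1 - t)

/-- The outer pieces cost a multiple of the energy dissipated by the flow. In the middle,
contraction costs `exp (2 * κ * τ)` and compressing time to length `1 - 2 * τ` costs its reciprocal.
-/
theorem regularised_hasEnergyBound (hE : IsAdmissibleEnergy E) {κ : ℝ} {S : X → ℝ → X}
    (hS : ∀ z, S z 0 = z ∧ IsDescentCurve E κ (S z)) {γ : ℝ → X} (hγ : IsAC2 γ)
    (h0 : E (γ 0) < ⊤) (h1 : E (γ 1) < ⊤) {τ : ℝ} (hτ : 0 < τ) (hτ' : τ < 1 / 4)
    (hsmall : κ * τ ≤ 1 / 2) :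
    ∃ e, HasEnergyBound (regularised S γ τ) e 0 1 ∧
      e 1 - e 0 = 4 * ((E (γ 0)).toReal - (E (S (γ 0) τ)).toReal)
        + Real.exp (2 * κ * τ) / (1 - 2 * τ) * (2 * (kinetic γ).toReal)
        + 4 * ((E (γ 1)).toReal - (E (S (γ 1) τ)).toReal) := by
  have hpos : 0 < 1 - 2 * τ := by linarith
  have hb1 := (hS (γ 0)).2.hasEnergyBound hE (by rwa [(hS (γ 0)).1]) hsmall
  have hb3 := ((hS (γ 1)).2.hasEnergyBound hE (by rwa [(hS (γ 1)).1]) hsmall).reverse (c := 1)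
  rw [sub_zero] at hb3
  have hb2 : HasEnergyBound (fun t => S (γ ((t - τ) / (1 - 2 * τ))) τ)
      (fun t => Real.exp (2 * κ * τ) / (1 - 2 * τ) * energy γ 0 ((t - τ) / (1 - 2 * τ)))
      τ (1 - τ) := by
    intro s t hs hst ht
    set a := (s - τ) / (1 - 2 * τ) with ha
    set b := (t - τ) / (1 - 2 * τ) with hb
    have ha0 : 0 ≤ a := div_nonneg (by linarith) hpos.le
    have hab : a ≤ b := by rw [ha, hb]; gcongr
    have hb1 : b ≤ 1 := by rw [hb, div_le_one hpos]; linarith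
    have hc := (hS (γ a)).2.dist_sq_le_exp hE (hS (γ b)).2 le_rfl hτ.le
    rw [(hS (γ a)).1, (hS (γ b)).1, sub_zero] at hc
    have he := hγ.hasEnergyBound a b ha0 hab hb1
    have hdiff : b - a = (t - s) / (1 - 2 * τ) := by rw [ha, hb]; ring
    rw [hdiff] at he
    calc dist (S (γ a) τ) (S (γ b) τ) ^ 2
        ≤ dist (γ a) (γ b) ^ 2 * Real.exp (2 * κ * τ) := hc
      _ ≤ ((t - s) / (1 - 2 * τ) * (energy γ 0 b - energy γ 0 a)) * Real.exp (2 * κ * τ) := by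
          gcongr
      _ = _ := by ring
  have hend : (1 - τ - τ) / (1 - 2 * τ) = 1 := by
    rw [div_eq_one_iff_eq hpos.ne']; ring
  obtain ⟨e', he', hd'⟩ := hb1.glue hτ.le (by linarith) hb2 (by simp)
  obtain ⟨e, he, hd⟩ := he'.glue (by linarith) (by linarith) hb3
    (by simp only [if_neg (show ¬ (1 - τ ≤ τ) by linarith), hend]; simp)
  refine ⟨e, he, ?_⟩
  rw [hd, hd', hend, hγ.energy_eq]
  simp [energy_self, (hS _).1]
  ring

/-- On the outer pieces the slope is below the metric speed, already square integrable; in the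
middle it is uniformly bounded because the flow has run for time `τ` from a bounded set. -/
theorem fisher_regularised_lt_top (hE : IsAdmissibleEnergy E) {κ : ℝ} {S : X → ℝ → X}
    (hS : ∀ z, S z 0 = z ∧ IsDescentCurve E κ (S z)) {γ : ℝ → X} (hγ : IsAC2 γ)
    (h0 : E (γ 0) < ⊤) (h1 : E (γ 1) < ⊤) {τ : ℝ} (hτ : 0 < τ) (hτ' : τ < 1 / 4)
    (hsmall : κ * τ ≤ 1 / 2) : fisher E (regularised S γ τ) < ⊤ := by
  obtain ⟨e, he, -⟩ := regularised_hasEnergyBound hE hS hγ h0 h1 hτ hτ' hsmall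
  have hpos : 0 < 1 - 2 * τ := by linarith
  obtain ⟨R, hR⟩ := (isCompact_Icc.image_of_continuousOn
    (hγ.1.continuousOn zero_le_one)).isBounded.subset_closedBall (γ 0)
  obtain ⟨K, hK⟩ := (hS (γ 0)).2.exists_slope_le hE (by rwa [(hS (γ 0)).1]) hτ hsmall R
  set w := regularised S γ τ with hw
  have hae : ∀ᵐ t : ℝ, t ≠ τ ∧ t ≠ 1 - τ := by
    have a1 : ∀ᵐ t : ℝ, t ≠ τ := by simp [ae_iff, measure_singleton]
    have a2 : ∀ᵐ t : ℝ, t ≠ 1 - τ := by simp [ae_iff, measure_singleton]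
    exact a1.and a2
  have key : ∫⁻ t in Ioo (0 : ℝ) 1, slope E (w t) ^ 2
      ≤ ∫⁻ t in Ioo (0 : ℝ) 1, (metricSpeed w t ^ 2 + ENNReal.ofReal K ^ 2) := by
    refine lintegral_mono_ae ((ae_restrict_iff' measurableSet_Ioo).2 ?_)
    filter_upwards [hae] with t ⟨ht1, ht2⟩ htI
    rcases lt_or_gt_of_ne ht2 with hlt2 | hgt2
    · rcases lt_or_gt_of_ne ht1 with hlt1 | hgt1
      · have heq : w =ᶠ[𝓝 t] S (γ 0) := by
          filter_upwards [Iio_mem_nhds hlt1] with s hs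
          have hs' : s < τ := hs
          simp only [hw, regularised]
          rw [if_pos (by linarith), if_pos hs'.le]
        refine le_add_right ?_
        rw [metricSpeed_congr heq, heq.self_of_nhds]
        gcongr
        exact (hS (γ 0)).2.slope_le_metricSpeed hE htI.1
      · have heq : w t = S (γ ((t - τ) / (1 - 2 * τ))) τ := by
          simp only [hw, regularised]
          rw [if_pos hlt2.le, if_neg (not_le.2 hgt1)]
        refine le_add_left ?_
        rw [heq]
        gcongr
        refine hK _ (hS _).2 ?_
        rw [(hS _).1, (hS _).1]
        refine hR (mem_image_of_mem γ ⟨div_nonneg (by linarith) hpos.le, ?_⟩)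
        rw [div_le_one hpos]; linarith
    · have heq : w =ᶠ[𝓝 t] fun s => S (γ 1) (1 - s) := by
        filter_upwards [Ioi_mem_nhds hgt2] with s hs
        simp only [hw, regularised]
        rw [if_neg (not_le.2 hs)]
      refine le_add_right ?_
      rw [metricSpeed_congr heq, heq.self_of_nhds, metricSpeed_comp_one_sub]
      gcongr
      exact (hS (γ 1)).2.slope_le_metricSpeed hE (by linarith [htI.2])
  rw [fisher]
  refine ENNReal.mul_lt_top (by simp) (key.trans_lt ?_)
  rw [lintegral_add_right _ measurable_const]
  refine ENNReal.add_lt_top.2 ⟨(he.lintegral_metricSpeed_sq_le zero_le_one).trans_lt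
    ENNReal.ofReal_lt_top, ?_⟩
  simp

/-- Curves joining points of the domain of `E` can be approximated in kinetic energy by curves with
finite Fisher information. -/
theorem exists_joins_fisher_lt_top (hE : IsAdmissibleEnergy E) {γ : ℝ → X} (hγ : IsAC2 γ)
    (h0 : E (γ 0) < ⊤) (h1 : E (γ 1) < ⊤) {η : ℝ} (hη : 0 < η) :
    ∃ w, Joins w (γ 0) (γ 1) ∧ kinetic w ≤ kinetic γ + ENNReal.ofReal η ∧ fisher E w < ⊤ := by
  obtain ⟨κ, S, hκ, hS⟩ := hE.exists_descent
  set A := (kinetic γ).toReal with hA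
  have hc : Tendsto (fun τ : ℝ => Real.exp (2 * κ * τ) / (1 - 2 * τ) * A) (𝓝[>] 0)
      (𝓝 (Real.exp (2 * κ * 0) / (1 - 2 * 0) * A)) := by
    refine ContinuousAt.tendsto (f := fun τ : ℝ => Real.exp (2 * κ * τ) / (1 - 2 * τ) * A) ?_
      |>.mono_left nhdsWithin_le_nhds
    refine ContinuousAt.mul (ContinuousAt.div (by fun_prop) (by fun_prop) (by norm_num)) (by fun_prop)
  simp only [mul_zero, Real.exp_zero, sub_zero, div_one, one_mul] at hc
  -- After the factors 4 and `1 / 2`, each end contributes at most `η / 4`; with `η / 4` from the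
  -- middle the total stays below `η`.
  have hflow : ∀ z, E z < ⊤ → ∀ᶠ τ in 𝓝[>] 0, (E z).toReal - η / 8 < (E (S z τ)).toReal := by
    intro z hz
    have hcs : Tendsto (S z) (𝓝[>] 0) (𝓝 z) := by
      have := ((hS z).2.cont 0 self_mem_Ici).tendsto
      rw [(hS z).1] at this
      exact this.mono_left (nhdsWithin_mono _ Ioi_subset_Ici_self)
    filter_upwards [hcs.eventually (hE.eventually_lt_toReal hz
      (show (E z).toReal - η / 8 < _ by linarith)), self_mem_nhdsWithin] with τ h2 hτ
    exact h2 ((hS z).2.lt_top τ hτ)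
  have hτ0 : (0 : ℝ) < min (1 / 4) (1 / (2 * κ + 1)) := lt_min (by norm_num) (by positivity)
  obtain ⟨τ, ⟨⟨hτA, hτx⟩, hτy⟩, hτI⟩ := ((((hc.eventually (gt_mem_nhds
    (show A < A + η / 4 by linarith))).and (hflow _ h0)).and (hflow _ h1)).and
    (Ioo_mem_nhdsGT hτ0)).exists
  have hτ4 : τ < 1 / 4 := hτI.2.trans_le (min_le_left _ _)
  have hsmall : κ * τ ≤ 1 / 2 := by
    have := (hτI.2.trans_le (min_le_right _ _)).le
    calc κ * τ ≤ κ * (1 / (2 * κ + 1)) := by gcongr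
      _ ≤ 1 / 2 := by rw [mul_one_div, div_le_div_iff₀ (by positivity) (by norm_num)]; linarith
  obtain ⟨e, he, hed⟩ := regularised_hasEnergyBound hE hS hγ h0 h1 hτI.1 hτ4 hsmall
  refine ⟨regularised S γ τ, ⟨he.continuousOn zero_le_one, ?_, ?_⟩, ?_,
    fisher_regularised_lt_top hE hS hγ h0 h1 hτI.1 hτ4 hsmall⟩
  · rw [regularised, if_pos (by linarith), if_pos hτI.1.le, (hS _).1]
  · rw [regularised, if_neg (by linarith [hτI.1]), sub_self, (hS _).1]
  · refine he.kinetic_le.trans ?_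
    rw [← ENNReal.ofReal_toReal (kinetic_lt_top_iff.2 hγ).ne,
      ← ENNReal.ofReal_add ENNReal.toReal_nonneg hη.le]
    apply ENNReal.ofReal_le_ofReal
    rw [hed]
    linarith

end Regularisation

/-! ### Weak compactness of curves and lower semicontinuity of both functionals. -/

section Compactness

/-- Diagonal extraction of a subsequence. -/
theorem exists_strictMono_forall_tendsto {Y : Type*} (l : Y → Filter Y) (u : ℕ → ℕ → Y)
    (h : ∀ (k : ℕ) (φ : ℕ → ℕ), ∃ z, ∃ ψ : ℕ → ℕ, StrictMono ψ ∧
      Tendsto (fun n => u k (φ (ψ n))) atTop (l z)) :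
    ∃ φ : ℕ → ℕ, StrictMono φ ∧ ∀ k, ∃ z, Tendsto (fun n => u k (φ n)) atTop (l z) := by
  choose z ψ hψ hz using h
  let Φ : ℕ → ℕ → ℕ := fun k => Nat.rec id (fun k φ => φ ∘ ψ k φ) k
  have hΦs : ∀ k, Φ (k + 1) = Φ k ∘ ψ k (Φ k) := fun k => rfl
  have hmono : ∀ k, StrictMono (Φ k) := by
    intro k
    induction k with
    | zero => exact strictMono_id
    | succ k ih => rw [hΦs]; exact ih.comp (hψ _ _)
  have hfac : ∀ k n, k ≤ n → ∃ θ : ℕ → ℕ, (∀ m, m ≤ θ m) ∧ ∀ m, Φ n m = Φ k (θ m) := by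
    intro k n hkn
    induction n, hkn using Nat.le_induction with
    | base => exact ⟨id, fun _ => le_rfl, fun _ => rfl⟩
    | succ n hkn ih =>
      obtain ⟨θ, h1, h2⟩ := ih
      exact ⟨fun m => θ (ψ n (Φ n) m), fun m => ((hψ n (Φ n)).le_apply).trans (h1 _),
        fun m => by rw [hΦs, Function.comp_apply, h2]⟩
  refine ⟨fun n => Φ n n, strictMono_nat_of_lt_succ fun n => ?_, fun k => ⟨z k (Φ k), ?_⟩⟩
  · rw [hΦs, Function.comp_apply]
    exact hmono n (n.lt_succ_self.trans_le (hψ n (Φ n)).le_apply)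
  -- From index `k + 1` on, the diagonal takes values of `Φ (k + 1)` at indices tending to infinity,
  -- which is all that `Tendsto` needs.
  · have h1 : ∀ n, ∃ m, n ≤ m ∧ (k + 1 ≤ n → Φ n n = Φ (k + 1) m) := by
      intro n
      by_cases hn : k + 1 ≤ n
      · obtain ⟨θ, h2, h3⟩ := hfac (k + 1) n hn
        exact ⟨θ n, h2 n, fun _ => h3 n⟩
      · exact ⟨n, le_rfl, fun hh => absurd hh hn⟩
    choose m hm hm' using h1
    refine ((hz k (Φ k)).comp (tendsto_atTop_mono hm tendsto_id)).congr' ?_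
    filter_upwards [eventually_ge_atTop (k + 1)] with n hn
    simp only [Function.comp_apply, hm' n hn, hΦs]

variable {X : Type*} [MetricSpace X] {E : X → EReal}

/-- Sequential compactness of bounded sets and sequential lower semicontinuity of the distance, for
a notion of convergence given by filters `σ z` playing the role of neighbourhood filters. -/
structure IsWeakConvergence (σ : X → Filter X) : Prop where
  pure_le : ∀ z, pure z ≤ σ z
  compact : ∀ u : ℕ → X, Bornology.IsBounded (range u) →
      ∃ z : X, ∃ φ : ℕ → ℕ, StrictMono φ ∧ Tendsto (u ∘ φ) atTop (σ z)
  lsc : ∀ (u v : ℕ → X) (z w : X), Tendsto u atTop (σ z) → Tendsto v atTop (σ w) →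
      edist z w ≤ liminf (fun n => edist (u n) (v n)) atTop

variable {σ : X → Filter X}

theorem IsWeakConvergence.eventually_lt_dist (hσ : IsWeakConvergence σ) {u v : ℕ → X} {z w : X}
    (hu : Tendsto u atTop (σ z)) (hv : Tendsto v atTop (σ w)) {r : ℝ}
    (hr : 0 ≤ r) (hlt : r < dist z w) : ∀ᶠ n in atTop, r < dist (u n) (v n) := by
  have h1 : ENNReal.ofReal r < liminf (fun n => edist (u n) (v n)) atTop := by
    refine lt_of_lt_of_le ?_ (hσ.lsc u v z w hu hv)
    rw [edist_dist]
    exact (ENNReal.ofReal_lt_ofReal_iff (hr.trans_lt hlt)).2 hlt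
  filter_upwards [eventually_lt_of_lt_liminf h1] with n hn
  rw [edist_dist] at hn
  exact (ENNReal.ofReal_lt_ofReal_iff_of_nonneg hr).1 hn

/-- Passing to the limit in an inequality for squared distances, along any finer filter. -/
theorem IsWeakConvergence.dist_sq_le_of_tendsto (hσ : IsWeakConvergence σ) {u v : ℕ → X} {z w : X}
    (hu : Tendsto u atTop (σ z)) (hv : Tendsto v atTop (σ w))
    {𝒰 : Filter ℕ} [𝒰.NeBot] (h𝒰 : 𝒰 ≤ atTop) {c : ℕ → ℝ} {c' : ℝ} (hc : Tendsto c 𝒰 (𝓝 c'))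
    (hle : ∀ n, dist (u n) (v n) ^ 2 ≤ c n) : dist z w ^ 2 ≤ c' := by
  have hc0 : 0 ≤ c' := ge_of_tendsto' hc fun n => (sq_nonneg _).trans (hle n)
  by_contra! hlt
  have h1 : √c' < dist z w := (Real.sqrt_lt' (by
    by_contra! h0
    have : dist z w = 0 := le_antisymm h0 dist_nonneg
    rw [this] at hlt
    linarith)).2 hlt
  obtain ⟨r, hr1, hr2⟩ := exists_between h1
  have hr0 : 0 ≤ r := (Real.sqrt_nonneg _).trans hr1.le
  have h2 := (hσ.eventually_lt_dist hu hv hr0 hr2).filter_mono h𝒰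
  have h3 : r ^ 2 ≤ c' := by
    refine ge_of_tendsto hc ?_
    filter_upwards [h2] with n hn
    exact le_trans (by gcongr) (hle n)
  have h4 := Real.le_sqrt_of_sq_le h3
  linarith

/-- Every subsequence has a weakly convergent further subsequence, and lower semicontinuity of the
distance to the constant sequence `z` identifies the limit. -/
theorem IsWeakConvergence.tendsto_of_tendsto (hσ : IsWeakConvergence σ) {u : ℕ → X} {z : X}
    (hu : Tendsto u atTop (𝓝 z)) : Tendsto u atTop (σ z) := by
  refine tendsto_of_subseq_tendsto fun ns hns => ?_
  obtain ⟨w, φ, hφ, hw⟩ := hσ.compact (u ∘ ns)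
    ((Metric.isBounded_range_of_tendsto u hu).subset (range_comp_subset_range ns u))
  refine ⟨φ, ?_⟩
  have hz : Tendsto (fun _ : ℕ => z) atTop (σ z) :=
    tendsto_const_pure.mono_right (hσ.pure_le z)
  have hd : Tendsto (fun n => dist ((u ∘ ns ∘ φ) n) z ^ 2) atTop (𝓝 (0 ^ 2)) :=
    ((tendsto_iff_dist_tendsto_zero.1 hu).comp (hns.comp hφ.tendsto_atTop)).pow 2
  have h1 := hσ.dist_sq_le_of_tendsto hw hz le_rfl hd fun n => le_rfl
  have h2 : dist w z = 0 := by
    have : dist w z ^ 2 = 0 := le_antisymm (by simpa using h1) (by positivity)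
    simpa using this
  rw [dist_eq_zero.1 h2] at hw
  exact hw

/-- Needed to have the slope Borel measurable along continuous curves when Fatou is applied. -/
theorem lowerSemicontinuous_slope (hσ : IsWeakConvergence σ)
    (hsl : ∀ (u : ℕ → X) (z : X), Tendsto u atTop (σ z) →
      slope E z ≤ liminf (fun n => slope E (u n)) atTop) : LowerSemicontinuous (slope E) := by
  rw [lowerSemicontinuous_iff_isClosed_preimage]
  intro c
  refine IsSeqClosed.isClosed fun u z hu hz => ?_
  have h1 := hsl u z (hσ.tendsto_of_tendsto hz)
  refine h1.trans ?_
  have h2 : liminf (fun n => slope E (u n)) atTop ≤ liminf (fun _ : ℕ => c) atTop :=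
    liminf_le_liminf (Eventually.of_forall hu)
  simpa using h2

/-- Equi-Hölder curves with a common starting point have a subsequence converging weakly at every
time. -/
theorem IsWeakConvergence.exists_limit_curve (hσ : IsWeakConvergence σ) {γ : ℕ → ℝ → X} {x : X} {C : ℝ}
    (h0 : ∀ n, γ n 0 = x)
    (hC : ∀ n, ∀ s ∈ Icc (0 : ℝ) 1, ∀ t ∈ Icc (0 : ℝ) 1,
      dist (γ n s) (γ n t) ^ 2 ≤ C * |t - s|) :
    ∃ (φ : ℕ → ℕ) (ω : ℝ → X), StrictMono φ ∧
      ∀ t ∈ Icc (0 : ℝ) 1, Tendsto (fun n => γ (φ n) t) atTop (σ (ω t)) := by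
  have hbdd : ∀ t ∈ Icc (0 : ℝ) 1, ∀ ns : ℕ → ℕ,
      Bornology.IsBounded (range fun n => γ (ns n) t) := by
    intro t ht ns
    refine (Metric.isBounded_closedBall (x := x) (r := √(C * |0 - t|))).subset ?_
    rintro _ ⟨n, rfl⟩
    rw [Metric.mem_closedBall]
    have := hC (ns n) t ht 0 ⟨le_rfl, zero_le_one⟩
    rw [h0] at this
    exact Real.le_sqrt_of_sq_le this
  obtain ⟨τ, hτ⟩ := TopologicalSpace.exists_dense_seq (Icc (0 : ℝ) 1)
  obtain ⟨φ, hφ, hz⟩ := exists_strictMono_forall_tendsto σ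
    (fun k n => γ n (τ k)) fun k φ => by
      obtain ⟨z, ψ, h1, h2⟩ := hσ.compact _ (hbdd (τ k) (τ k).2 φ)
      exact ⟨z, ψ, h1, h2⟩
  choose z hz using hz
  -- Any subsequential limit at `t` inherits the Hölder estimate against the limits `z k` at the
  -- dense times, and by density that pins it down. So the diagonal subsequence converges at every
  -- `t`.
  have hclose : ∀ t ∈ Icc (0 : ℝ) 1, ∀ ns : ℕ → ℕ, Tendsto ns atTop atTop → ∀ w,
      Tendsto (fun n => γ (φ (ns n)) t) atTop (σ w) →
      ∀ k, dist w (z k) ^ 2 ≤ C * |(τ k : ℝ) - t| := by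
    intro t ht ns hns w hw k
    exact hσ.dist_sq_le_of_tendsto hw ((hz k).comp hns) le_rfl tendsto_const_nhds
      fun n => hC _ t ht (τ k) (τ k).2
  have huniq : ∀ t ∈ Icc (0 : ℝ) 1, ∀ w w', (∀ k, dist w (z k) ^ 2 ≤ C * |(τ k : ℝ) - t|) →
      (∀ k, dist w' (z k) ^ 2 ≤ C * |(τ k : ℝ) - t|) → w = w' := by
    intro t ht w w' hw hw'
    by_contra hne
    have hpos : 0 < dist w w' := dist_pos.2 hne
    have hcont : Continuous fun s : Icc (0 : ℝ) 1 => 4 * (C * |(s : ℝ) - t|) := by fun_prop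
    obtain ⟨k, hk⟩ := hτ.exists_mem_open (isOpen_lt hcont continuous_const)
      (⟨⟨t, ht⟩, by simpa using pow_pos hpos 2⟩ :
        {s : Icc (0 : ℝ) 1 | 4 * (C * |(s : ℝ) - t|) < dist w w' ^ 2}.Nonempty)
    have hk' : 4 * (C * |(τ k : ℝ) - t|) < dist w w' ^ 2 := hk
    have h1 := hw k
    have h2 := hw' k
    have h3 := dist_triangle_right w w' (z k)
    have h4 : dist w w' ^ 2 ≤ (dist w (z k) + dist w' (z k)) ^ 2 := by gcongr
    nlinarith [sq_nonneg (dist w (z k) - dist w' (z k))]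
  have hlim : ∀ t ∈ Icc (0 : ℝ) 1, ∃ w, Tendsto (fun n => γ (φ n) t) atTop (σ w) := by
    intro t ht
    obtain ⟨w, ψ, hψ, hw⟩ := hσ.compact _ (hbdd t ht φ)
    refine ⟨w, tendsto_of_subseq_tendsto fun ns hns => ?_⟩
    obtain ⟨w', ψ', hψ', hw'⟩ := hσ.compact _ (hbdd t ht (φ ∘ ns))
    refine ⟨ψ', ?_⟩
    have : w' = w := huniq t ht w' w
      (hclose t ht (ns ∘ ψ') (hns.comp hψ'.tendsto_atTop) w' hw')
      (hclose t ht ψ hψ.tendsto_atTop w hw)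
    rw [this] at hw'
    exact hw'
  have : Nonempty X := ⟨x⟩
  choose! ω hω using hlim
  exact ⟨φ, ω, hφ, hω⟩

theorem energy_mono {γ : ℝ → X} (hγ : IsAC2 γ) {s t : ℝ} (hs : 0 ≤ s) (hst : s ≤ t) (ht : t ≤ 1) :
    energy γ 0 s ≤ energy γ 0 t :=
  hγ.hasEnergyBound.monotoneOn ⟨hs, hst.trans ht⟩ ⟨hs.trans hst, ht⟩ hst

theorem energy_nonneg (γ : ℝ → X) (a t : ℝ) : 0 ≤ energy γ a t := ENNReal.toReal_nonneg

/-- Compactness and lower semicontinuity of kinetic energy and Fisher information. -/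
theorem exists_joins_le_of_tendsto (hσ : HasWeakTopology E) {γ : ℕ → ℝ → X} {x y : X}
    {a b : ℝ≥0∞} (hγ : ∀ n, IsAC2 (γ n)) (h0 : ∀ n, γ n 0 = x) (h1 : ∀ n, γ n 1 = y)
    (ha : Tendsto (fun n => kinetic (γ n)) atTop (𝓝 a)) (ha_top : a < ⊤)
    (hb : Tendsto (fun n => fisher E (γ n)) atTop (𝓝 b)) :
    ∃ ω, Joins ω x y ∧ kinetic ω ≤ a ∧ fisher E ω ≤ b := by
  obtain ⟨σ, hw, hsl⟩ : ∃ σ : X → Filter X, IsWeakConvergence σ ∧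
      ∀ (u : ℕ → X) (z : X), Tendsto u atTop (σ z) →
        slope E z ≤ liminf (fun n => slope E (u n)) atTop := by
    obtain ⟨σ, -, hcomp, hlsc, hsl⟩ := hσ
    exact ⟨fun z => @nhds X σ z, ⟨fun z => @pure_le_nhds X σ z, hcomp, hlsc⟩, hsl⟩
  have hA : Tendsto (fun n => (kinetic (γ n)).toReal) atTop (𝓝 a.toReal) :=
    (ENNReal.tendsto_toReal ha_top.ne).comp ha
  obtain ⟨B, hB⟩ := hA.bddAbove_range
  have hBn : ∀ n, energy (γ n) 0 1 ≤ 2 * B := fun n => by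
    rw [(hγ n).energy_eq]
    have := hB (mem_range_self n)
    linarith
  have hle : ∀ n, ∀ s t, 0 ≤ s → s ≤ t → t ≤ 1 →
      dist (γ n s) (γ n t) ^ 2 ≤ 2 * B * |t - s| := by
    intro n s t hs hst ht
    refine ((hγ n).hasEnergyBound s t hs hst ht).trans ?_
    rw [abs_of_nonneg (sub_nonneg.2 hst), mul_comm]
    have i1 := energy_mono (hγ n) (hs.trans hst) ht le_rfl
    have i2 := energy_nonneg (γ n) 0 s
    have i3 := hBn n
    exact mul_le_mul_of_nonneg_right (by linarith) (sub_nonneg.2 hst)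
  obtain ⟨φ, ω, hφ, hω⟩ := hw.exists_limit_curve (C := 2 * B) h0 fun n s hs t ht => by
    rcases le_total s t with hst | hst
    · exact hle n s t hs.1 hst ht.2
    · rw [dist_comm, abs_sub_comm]
      exact hle n t s ht.1 hst hs.2
  have hconst : ∀ t ∈ Icc (0 : ℝ) 1, ∀ z, (∀ n, γ n t = z) → ω t = z := by
    intro t ht z hz
    have hd := hw.dist_sq_le_of_tendsto (hω t ht) (tendsto_const_pure.mono_right (hw.pure_le z)) le_rfl
      (tendsto_const_nhds (x := (0 : ℝ))) fun n => by simp [hz]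
    have : dist (ω t) z ^ 2 = 0 := le_antisymm hd (by positivity)
    simpa using this
  -- An ultrafilter gives limits of the energy functions at all times at once, with no further
  -- extraction; the two-point inequalities pass to the limit along it.
  have hlimE : ∀ t ∈ Icc (0 : ℝ) 1, ∃ c,
      Tendsto (fun n => energy (γ (φ n)) 0 t) (hyperfilter ℕ : Filter ℕ) (𝓝 c) := by
    intro t ht
    obtain ⟨c, -, hc⟩ := (isCompact_Icc (a := (0 : ℝ)) (b := 2 * B)).ultrafilter_le_nhds
      ((hyperfilter ℕ).map fun n => energy (γ (φ n)) 0 t) (by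
        refine le_principal_iff.2 (Filter.mem_map.2 (Filter.Eventually.of_forall fun n => ?_))
        exact ⟨energy_nonneg _ _ _, (energy_mono (hγ _) ht.1 ht.2 le_rfl).trans (hBn _)⟩)
    exact ⟨c, hc⟩
  choose! e he using hlimE
  have hUle : (hyperfilter ℕ : Filter ℕ) ≤ atTop := by
    rw [← Nat.cofinite_eq_atTop]; exact hyperfilter_le_cofinite
  have hbound : HasEnergyBound ω e 0 1 := by
    intro s t hs hst ht
    exact hw.dist_sq_le_of_tendsto (hω s ⟨hs, hst.trans ht⟩) (hω t ⟨hs.trans hst, ht⟩) hUle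
      (((he t ⟨hs.trans hst, ht⟩).sub (he s ⟨hs, hst.trans ht⟩)).const_mul (t - s))
      fun n => (hγ (φ n)).hasEnergyBound s t hs hst ht
  have he1 : e 1 = 2 * a.toReal := by
    refine tendsto_nhds_unique (he 1 ⟨zero_le_one, le_rfl⟩) ?_
    simp only [(hγ _).energy_eq]
    exact ((hA.comp hφ.tendsto_atTop).mono_left hUle).const_mul 2
  have he0 : e 0 = 0 := by
    refine tendsto_nhds_unique (he 0 ⟨le_rfl, zero_le_one⟩) ?_
    simp only [energy_self]
    exact tendsto_const_nhds
  refine ⟨ω, ⟨hbound.continuousOn zero_le_one, hconst 0 ⟨le_rfl, zero_le_one⟩ x h0,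
    hconst 1 ⟨zero_le_one, le_rfl⟩ y h1⟩, ?_, ?_⟩
  · refine hbound.kinetic_le.trans (le_of_eq ?_)
    rw [he1, he0, sub_zero, mul_div_cancel_left₀ _ two_ne_zero, ENNReal.ofReal_toReal ha_top.ne]
  · let _ : MeasurableSpace X := borel X
    have _ : BorelSpace X := ⟨rfl⟩
    have hmeas : ∀ n, AEMeasurable (fun t => slope E (γ (φ n) t) ^ 2)
        (volume.restrict (Ioo (0 : ℝ) 1)) := fun n =>
      ((lowerSemicontinuous_slope hw hsl).measurable.comp_aemeasurable
        ((((hγ (φ n)).1.continuousOn zero_le_one).mono Ioo_subset_Icc_self).aemeasurable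
          measurableSet_Ioo)).pow_const 2
    have hfatou : ∫⁻ t in Ioo (0 : ℝ) 1, slope E (ω t) ^ 2
        ≤ liminf (fun n => ∫⁻ t in Ioo (0 : ℝ) 1, slope E (γ (φ n) t) ^ 2) atTop := by
      refine le_trans ?_ (lintegral_liminf_le' hmeas)
      refine setLIntegral_mono' measurableSet_Ioo fun t ht => ?_
      have h2 := hsl _ _ (hω t ⟨ht.1.le, ht.2.le⟩)
      have hmono : Monotone fun r : ℝ≥0∞ => r ^ 2 := fun p q hpq =>
        pow_le_pow_left' hpq 2
      have h3 := hmono.map_liminf_of_continuousAt (F := atTop) (fun n => slope E (γ (φ n) t))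
        (ENNReal.continuous_pow 2).continuousAt
      calc slope E (ω t) ^ 2 ≤ (liminf (fun n => slope E (γ (φ n) t)) atTop) ^ 2 := hmono h2
        _ = _ := h3
    have h4 : Tendsto (fun n => ∫⁻ t in Ioo (0 : ℝ) 1, slope E (γ (φ n) t) ^ 2) atTop
        (𝓝 (2 * b)) := by
      have h5 := ENNReal.Tendsto.const_mul (a := 2) (hb.comp hφ.tendsto_atTop)
        (Or.inr ENNReal.ofNat_ne_top)
      refine h5.congr fun n => ?_
      rw [Function.comp_apply, fisher, ← mul_assoc, ENNReal.mul_inv_cancel (by simp) (by simp),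
        one_mul]
    rw [h4.liminf_eq] at hfatou
    calc fisher E ω ≤ 2⁻¹ * (2 * b) := by rw [fisher]; exact mul_le_mul' le_rfl hfatou
      _ = b := by rw [← mul_assoc, ENNReal.inv_mul_cancel (by simp) (by simp), one_mul]

end Compactness

/-! ### Lower envelopes of affine functions on the half-line. -/

section Envelope

/-- Points of `P` minimising `p ↦ p.1 + s p.2`, where `F s` is the infimum. -/
def optimal (P : Set (ℝ × ℝ)) (F : ℝ → ℝ) (s : ℝ) : Set (ℝ × ℝ) :=
  {p | p ∈ P ∧ p.1 + s * p.2 = F s}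

/-- `F` is the lower envelope on `(0, ∞)` of the affine functions `s ↦ p.1 + s p.2`, `p ∈ P`, where
`P` is nonempty, contained in the positive quadrant, and closed up to domination. -/
structure IsEnvelope (P : Set (ℝ × ℝ)) (F : ℝ → ℝ) : Prop where
  nonempty : P.Nonempty
  nonneg : ∀ p ∈ P, 0 ≤ p.1 ∧ 0 ≤ p.2
  closed : ∀ (p : ℕ → ℝ × ℝ) (q : ℝ × ℝ), (∀ n, p n ∈ P) → Tendsto p atTop (𝓝 q) →
    ∃ r ∈ P, r.1 ≤ q.1 ∧ r.2 ≤ q.2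
  isGLB : ∀ s, 0 < s → IsGLB ((fun p : ℝ × ℝ => p.1 + s * p.2) '' P) (F s)

variable {P : Set (ℝ × ℝ)} {F : ℝ → ℝ}

theorem IsEnvelope.le (h : IsEnvelope P F) {s : ℝ} (hs : 0 < s) {p : ℝ × ℝ} (hp : p ∈ P) :
    F s ≤ p.1 + s * p.2 :=
  (h.isGLB s hs).1 (mem_image_of_mem _ hp)

/-- A fixed competitor bounds both coordinates of near-minimisers, the second because `s > 0`. The
limit `q` may leave `P`, but it dominates some `r ∈ P`; since `q` is no worse than any competitor
and `s > 0`, equality `r = q` is forced. -/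
theorem IsEnvelope.exists_subseq_tendsto (h : IsEnvelope P F) {s : ℝ} (hs : 0 < s) {σ δ : ℕ → ℝ}
    (hσ0 : ∀ n, 0 < σ n) (hσ : Tendsto σ atTop (𝓝 s)) (hδ : Tendsto δ atTop (𝓝 0))
    {p : ℕ → ℝ × ℝ} (hp : ∀ n, p n ∈ P) (hle : ∀ n, (p n).1 + σ n * (p n).2 ≤ F (σ n) + δ n) :
    ∃ q ∈ optimal P F s, ∃ φ : ℕ → ℕ, StrictMono φ ∧ Tendsto (p ∘ φ) atTop (𝓝 q) := by
  obtain ⟨p₀, hp₀⟩ := h.nonempty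
  have hle' : ∀ r ∈ P, ∀ n, (p n).1 + σ n * (p n).2 ≤ r.1 + σ n * r.2 + δ n := fun r hr n =>
    (hle n).trans (by linarith [h.le (hσ0 n) hr])
  have hlim : ∀ r : ℝ × ℝ, Tendsto (fun n => r.1 + σ n * r.2 + δ n) atTop
      (𝓝 (r.1 + s * r.2)) := fun r => by
    simpa using ((hσ.mul_const r.2).const_add r.1).add hδ
  obtain ⟨M, hM⟩ := (hlim p₀).bddAbove_range
  have hM' : ∀ n, (p n).1 + σ n * (p n).2 ≤ M := fun n =>
    (hle' p₀ hp₀ n).trans (hM (mem_range_self n))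
  have hev : ∀ᶠ n in atTop, p n ∈ Icc (0 : ℝ) M ×ˢ Icc (0 : ℝ) (2 * M / s) := by
    filter_upwards [hσ.eventually (lt_mem_nhds (show s / 2 < s by linarith))] with n hn
    obtain ⟨h1, h2⟩ := h.nonneg _ (hp n)
    have h3 := hM' n
    have h4 : s / 2 * (p n).2 ≤ σ n * (p n).2 := by gcongr
    have h5 : 0 ≤ s / 2 * (p n).2 := by positivity
    refine ⟨⟨h1, by linarith⟩, h2, ?_⟩
    rw [le_div_iff₀ hs]
    linarith
  obtain ⟨q, -, φ, hφ, hq⟩ := (isCompact_Icc.prod isCompact_Icc).tendsto_subseq'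
    hev.frequently
  obtain ⟨r, hr, hr1, hr2⟩ := h.closed (p ∘ φ) q (fun n => hp _) hq
  have hqle : ∀ r ∈ P, q.1 + s * q.2 ≤ r.1 + s * r.2 := by
    intro r hr
    refine le_of_tendsto_of_tendsto' ?_ ((hlim r).comp hφ.tendsto_atTop) fun n => hle' r hr (φ n)
    exact ((continuous_fst.tendsto q).comp hq).add
      ((hσ.comp hφ.tendsto_atTop).mul ((continuous_snd.tendsto q).comp hq))
  have hqF : q.1 + s * q.2 ≤ F s := by
    refine (h.isGLB s hs).2 ?_
    rintro _ ⟨r, hr, rfl⟩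
    exact hqle r hr
  have hrF := h.le hs hr
  have hmul : s * r.2 ≤ s * q.2 := by gcongr
  have e1 : r.1 = q.1 := by linarith
  have e2 : r.2 = q.2 := le_antisymm hr2 (le_of_mul_le_mul_left (by linarith) hs)
  have hrq : r = q := Prod.ext e1 e2
  subst hrq
  exact ⟨r, ⟨hr, le_antisymm hqF hrF⟩, φ, hφ, hq⟩

theorem IsEnvelope.optimal_nonempty (h : IsEnvelope P F) {s : ℝ} (hs : 0 < s) :
    (optimal P F s).Nonempty := by
  have h1 : ∀ n : ℕ, ∃ p ∈ P, p.1 + s * p.2 ≤ F s + 1 / ((n : ℝ) + 1) := by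
    intro n
    have hpos : (0 : ℝ) < 1 / ((n : ℝ) + 1) := by positivity
    obtain ⟨_, ⟨p, hp, rfl⟩, -, hlt⟩ := (h.isGLB s hs).exists_between (lt_add_of_pos_right (F s) hpos)
    exact ⟨p, hp, hlt.le⟩
  choose p hp hle using h1
  obtain ⟨q, hq, -⟩ := h.exists_subseq_tendsto hs (fun _ => hs) tendsto_const_nhds
    tendsto_one_div_add_atTop_nhds_zero_nat hp hle
  exact ⟨q, hq⟩

theorem IsEnvelope.isCompact_optimal (h : IsEnvelope P F) {s : ℝ} (hs : 0 < s) :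
    IsCompact (optimal P F s) := by
  refine IsSeqCompact.isCompact fun p hp => ?_
  obtain ⟨q, hq, φ, hφ, hlim⟩ := h.exists_subseq_tendsto hs (σ := fun _ => s) (δ := fun _ => 0)
    (fun _ => hs) tendsto_const_nhds tendsto_const_nhds (fun n => (hp n).1)
    fun n => by rw [(hp n).2, add_zero]
  exact ⟨q, hq, φ, hφ, hlim⟩

/-- Upper hemicontinuity of the optimal points. -/
theorem IsEnvelope.eventually_optimal_subset (h : IsEnvelope P F) {s : ℝ} (hs : 0 < s)
    {U : Set (ℝ × ℝ)} (hU : IsOpen U) (hsub : optimal P F s ⊆ U) :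
    ∀ᶠ t in 𝓝 s, optimal P F t ⊆ U := by
  by_contra hcon
  have h1 : ∃ᶠ t in 𝓝 s, ¬ optimal P F t ⊆ U ∧ 0 < t :=
    (not_eventually.1 hcon).and_eventually (lt_mem_nhds hs)
  obtain ⟨σ, hσ, hσU⟩ := exists_seq_forall_of_frequently h1
  have h2 : ∀ n, ∃ p ∈ optimal P F (σ n), p ∉ U := fun n => not_subset.1 (hσU n).1
  choose p hp hpU using h2
  obtain ⟨q, hq, φ, -, hlim⟩ := h.exists_subseq_tendsto hs (δ := fun _ => 0)
    (fun n => (hσU n).2) hσ tendsto_const_nhds (fun n => (hp n).1)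
    fun n => by rw [(hp n).2, add_zero]
  exact (hU.isClosed_compl.mem_of_tendsto hlim (Eventually.of_forall fun n => hpU (φ n)))
    (hsub hq)

theorem IsEnvelope.snd_le_snd (h : IsEnvelope P F) {s t : ℝ} (hs : 0 < s) (hst : s < t)
    {p q : ℝ × ℝ} (hp : p ∈ optimal P F s) (hq : q ∈ optimal P F t) : q.2 ≤ p.2 := by
  have h1 := h.le hs hq.1
  have h2 := h.le (hs.trans hst) hp.1
  rw [← hp.2] at h1
  rw [← hq.2] at h2
  nlinarith

/-- Each optimal line is used as a competitor at the other parameter. -/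
theorem IsEnvelope.slope_mem (h : IsEnvelope P F) {s t : ℝ} (hs : 0 < s) (hst : s < t)
    {p q : ℝ × ℝ} (hp : p ∈ optimal P F s) (hq : q ∈ optimal P F t) :
    _root_.slope F s t ∈ Icc q.2 p.2 := by
  have h1 := h.le hs hq.1
  have h2 := h.le (hs.trans hst) hp.1
  have hpos : 0 < t - s := by linarith
  rw [slope_def_field]
  constructor
  · rw [le_div_iff₀ hpos, ← hq.2]; linarith
  · rw [div_le_iff₀ hpos, ← hp.2]; linarith

/-- One-sided derivatives of the envelope, and their one-sided continuity. -/
theorem IsEnvelope.exists_right_deriv (h : IsEnvelope P F) :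
    ∃ m : ℝ → ℝ, ∀ s, 0 < s →
      (∃ q ∈ optimal P F s, q.2 = m s ∧ ∀ p ∈ optimal P F s, m s ≤ p.2) ∧
      HasDerivWithinAt F (m s) (Ici s) s ∧ ContinuousWithinAt m (Ici s) s := by
  have h1 : ∀ s, 0 < s → ∃ q ∈ optimal P F s, ∀ p ∈ optimal P F s, q.2 ≤ p.2 := fun s hs =>
    (h.isCompact_optimal hs).exists_isMinOn (h.optimal_nonempty hs) continuous_snd.continuousOn
  choose! q hq hmin using h1
  refine ⟨fun s => (q s).2, fun s hs => ⟨⟨q s, hq s hs, rfl, hmin s hs⟩, ?_, ?_⟩⟩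
  · rw [hasDerivWithinAt_iff_tendsto_slope, Ici_sdiff_left]
    refine Metric.tendsto_nhds.2 fun δ hδ => ?_
    have h2 := h.eventually_optimal_subset hs (isOpen_lt continuous_const continuous_snd)
      (fun p hp => show (q s).2 - δ < p.2 by linarith [hmin s hs p hp])
    filter_upwards [h2.filter_mono nhdsWithin_le_nhds, self_mem_nhdsWithin] with t ht hst
    have hst' : s < t := hst
    -- The quotient lies between `(q t).2` and `(q s).2`, and hemicontinuity keeps the former above
    -- `(q s).2 - δ`.
    have h3 := h.slope_mem hs hst' (hq s hs) (hq t (hs.trans hst'))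
    have h4 : (q s).2 - δ < (q t).2 := ht (hq t (hs.trans hst'))
    rw [Real.dist_eq, abs_lt]
    constructor <;> linarith [h3.1, h3.2]
  · refine Metric.tendsto_nhds.2 fun δ hδ => ?_
    have h2 := h.eventually_optimal_subset hs (isOpen_lt continuous_const continuous_snd)
      (fun p hp => show (q s).2 - δ < p.2 by linarith [hmin s hs p hp])
    filter_upwards [h2.filter_mono nhdsWithin_le_nhds, self_mem_nhdsWithin] with t ht hst
    rcases (mem_Ici.1 hst).eq_or_lt with rfl | hst'
    · simpa using hδ
    have h3 := h.snd_le_snd hs hst' (hq s hs) (hq t (hs.trans hst'))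
    have h4 : (q s).2 - δ < (q t).2 := ht (hq t (hs.trans hst'))
    rw [Real.dist_eq, abs_lt]
    constructor <;> linarith

theorem IsEnvelope.exists_left_deriv (h : IsEnvelope P F) :
    ∃ m : ℝ → ℝ, ∀ s, 0 < s →
      (∃ q ∈ optimal P F s, q.2 = m s ∧ ∀ p ∈ optimal P F s, p.2 ≤ m s) ∧
      HasDerivWithinAt F (m s) (Iic s) s ∧ ContinuousWithinAt m (Iic s) s := by
  have h1 : ∀ s, 0 < s → ∃ q ∈ optimal P F s, ∀ p ∈ optimal P F s, p.2 ≤ q.2 := fun s hs =>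
    (h.isCompact_optimal hs).exists_isMaxOn (h.optimal_nonempty hs) continuous_snd.continuousOn
  choose! q hq hmax using h1
  refine ⟨fun s => (q s).2, fun s hs => ⟨⟨q s, hq s hs, rfl, hmax s hs⟩, ?_, ?_⟩⟩
  · rw [hasDerivWithinAt_iff_tendsto_slope, Iic_sdiff_right]
    refine Metric.tendsto_nhds.2 fun δ hδ => ?_
    have h2 := h.eventually_optimal_subset hs (isOpen_lt continuous_snd continuous_const)
      (fun p hp => show p.2 < (q s).2 + δ by linarith [hmax s hs p hp])
    filter_upwards [h2.filter_mono nhdsWithin_le_nhds, self_mem_nhdsWithin,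
      nhdsWithin_le_nhds (lt_mem_nhds hs)] with t ht hst ht0
    have hst' : t < s := hst
    have h3 := h.slope_mem ht0 hst' (hq t ht0) (hq s hs)
    have h4 : (q t).2 < (q s).2 + δ := ht (hq t ht0)
    rw [slope_comm, Real.dist_eq, abs_lt]
    constructor <;> linarith [h3.1, h3.2]
  · refine Metric.tendsto_nhds.2 fun δ hδ => ?_
    have h2 := h.eventually_optimal_subset hs (isOpen_lt continuous_snd continuous_const)
      (fun p hp => show p.2 < (q s).2 + δ by linarith [hmax s hs p hp])
    filter_upwards [h2.filter_mono nhdsWithin_le_nhds, self_mem_nhdsWithin,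
      nhdsWithin_le_nhds (lt_mem_nhds hs)] with t ht hst ht0
    rcases (mem_Iic.1 hst).eq_or_lt with rfl | hst'
    · simpa using hδ
    have h3 := h.snd_le_snd ht0 hst' (hq t ht0) (hq s hs)
    have h4 : (q t).2 < (q s).2 + δ := ht (hq t ht0)
    rw [Real.dist_eq, abs_lt]
    constructor <;> linarith

theorem hasDerivWithinAt_comp_sq_Ici {m ε : ℝ} (hε : 0 < ε)
    (h : HasDerivWithinAt F m (Ici (ε ^ 2)) (ε ^ 2)) :
    HasDerivWithinAt (fun t => F (t ^ 2)) (2 * ε * m) (Ici ε) ε := by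
  have h1 : HasDerivWithinAt (fun t : ℝ => t ^ 2) (2 * ε) (Ici ε) ε := by
    simpa using (hasDerivAt_pow 2 ε).hasDerivWithinAt
  have h2 := HasDerivWithinAt.comp (h₂ := F) (h := fun t : ℝ => t ^ 2) ε h h1 fun t (ht : ε ≤ t) => by
    exact mem_Ici.2 (pow_le_pow_left₀ hε.le ht 2)
  rw [mul_comm m] at h2
  exact h2

theorem hasDerivWithinAt_comp_sq_Iic {m ε : ℝ} (hε : 0 < ε)
    (h : HasDerivWithinAt F m (Iic (ε ^ 2)) (ε ^ 2)) :
    HasDerivWithinAt (fun t => F (t ^ 2)) (2 * ε * m) (Iic ε) ε := by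
  -- `Icc 0 ε` instead of `Iic ε`, since squaring maps `t < -ε` outside `Iic (ε ^ 2)`.
  have h1 : HasDerivWithinAt (fun t : ℝ => t ^ 2) (2 * ε) (Icc 0 ε) ε := by
    simpa using (hasDerivAt_pow 2 ε).hasDerivWithinAt
  have h2 := HasDerivWithinAt.comp (h₂ := F) (h := fun t : ℝ => t ^ 2) ε h h1 fun t (ht : t ∈ Icc 0 ε) => by
    exact mem_Iic.2 (pow_le_pow_left₀ ht.1 ht.2 2)
  rw [mul_comm m] at h2
  refine HasDerivWithinAt.mono_of_mem_nhdsWithin h2 ?_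
  exact Icc_mem_nhdsLE hε

/-- A continuous function with nonnegative right derivatives is absolutely continuous. -/
theorem absolutelyContinuousOnInterval_of_right_deriv_nonneg {g g' : ℝ → ℝ} {a b : ℝ} (hab : a ≤ b)
    (hcont : ContinuousOn g (Icc a b))
    (hderiv : ∀ t ∈ Ioo a b, HasDerivWithinAt g (g' t) (Ioi t) t)
    (hnn : ∀ t ∈ Ioo a b, 0 ≤ g' t) : AbsolutelyContinuousOnInterval g a b := by
  have hint : IntervalIntegrable g' volume a b :=
    (intervalIntegrable_iff_integrableOn_Ioc_of_le hab).2
      (intervalIntegral.integrableOn_deriv_right_of_nonneg hcont hderiv hnn)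
  have hftc : ∀ t ∈ Icc a b, ∫ r in a..t, g' r = g t - g a := fun t ht =>
    intervalIntegral.integral_eq_sub_of_hasDeriv_right_of_le ht.1
      (hcont.mono (Icc_subset_Icc_right ht.2)) (fun r hr => hderiv r ⟨hr.1, hr.2.trans_le ht.2⟩)
      (hint.mono_set (by rw [uIcc_of_le hab, uIcc_of_le ht.1]; exact Icc_subset_Icc_right ht.2))
  refine (hint.absolutelyContinuousOnInterval_intervalIntegral (c := a) (by simp)).of_dist_le ?_
  rw [uIcc_of_le hab]
  intro s hs t ht
  rw [hftc s hs, hftc t ht, dist_sub_right]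

end Envelope

/-! ### The cost as an envelope in `s = ε²`, and its continuity at zero. -/

section Cost

variable {X : Type*} [MetricSpace X] {E : X → EReal} {x y : X}

/-- The cost as a function of `s = ε²`. -/
noncomputable def costSq (E : X → EReal) (x y : X) (s : ℝ) : ℝ≥0∞ :=
  ⨅ (γ : ℝ → X) (_ : Joins γ x y), (kinetic γ + ENNReal.ofReal s * fisher E γ)

theorem cost_eq_costSq (ε : ℝ) : cost E x y ε = costSq E x y (ε ^ 2) := rfl

/-- Curves from `x` to `y` with finite kinetic energy and Fisher information. -/
def regularCurves (E : X → EReal) (x y : X) : Set (ℝ → X) :=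
  {γ | IsAC2 γ ∧ γ 0 = x ∧ γ 1 = y ∧ fisher E γ < ⊤}

/-- Kinetic energy and Fisher information, as real numbers. -/
noncomputable def energyPair (E : X → EReal) (γ : ℝ → X) : ℝ × ℝ :=
  ((kinetic γ).toReal, (fisher E γ).toReal)

theorem IsAC2.joins {γ : ℝ → X} (h : IsAC2 γ) (h0 : γ 0 = x) (h1 : γ 1 = y) : Joins γ x y :=
  ⟨h.1.continuousOn zero_le_one, h0, h1⟩

theorem costSq_le {γ : ℝ → X} (h : Joins γ x y) (s : ℝ) :
    costSq E x y s ≤ kinetic γ + ENNReal.ofReal s * fisher E γ :=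
  iInf₂_le γ h

theorem ofReal_energyPair {γ : ℝ → X} (h : γ ∈ regularCurves E x y) {s : ℝ} (hs : 0 ≤ s) :
    ENNReal.ofReal ((energyPair E γ).1 + s * (energyPair E γ).2)
      = kinetic γ + ENNReal.ofReal s * fisher E γ := by
  simp only [energyPair]
  rw [ENNReal.ofReal_add ENNReal.toReal_nonneg (mul_nonneg hs ENNReal.toReal_nonneg),
    ENNReal.ofReal_mul hs, ENNReal.ofReal_toReal (kinetic_lt_top_iff.2 h.1).ne,
    ENNReal.ofReal_toReal h.2.2.2.ne]

theorem costSq_lt_top (hne : (regularCurves E x y).Nonempty) (s : ℝ) : costSq E x y s < ⊤ := by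
  obtain ⟨γ, hγ⟩ := hne
  refine (costSq_le (hγ.1.joins hγ.2.1 hγ.2.2.1) s).trans_lt ?_
  exact ENNReal.add_lt_top.2 ⟨kinetic_lt_top_iff.2 hγ.1,
    ENNReal.mul_lt_top ENNReal.ofReal_lt_top hγ.2.2.2⟩

theorem mem_regularCurves_of_lt_top {γ : ℝ → X} (h : Joins γ x y) {s : ℝ} (hs : 0 < s)
    (hlt : kinetic γ + ENNReal.ofReal s * fisher E γ < ⊤) : γ ∈ regularCurves E x y := by
  obtain ⟨h1, h2⟩ := ENNReal.add_lt_top.1 hlt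
  refine ⟨kinetic_lt_top_iff.1 h1, h.2.1, h.2.2, ?_⟩
  by_contra hcon
  rw [not_lt, top_le_iff] at hcon
  rw [hcon, ENNReal.mul_top (by simpa using hs)] at h2
  exact lt_irrefl _ h2

/-- Closedness up to domination is exactly the compactness theorem. Restricting the infimum to
regular curves is harmless for `s > 0`, as every other curve has infinite action. -/
theorem isEnvelope_costSq (hσ : HasWeakTopology E) (hne : (regularCurves E x y).Nonempty) :
    IsEnvelope (energyPair E '' regularCurves E x y) (fun s => (costSq E x y s).toReal) where
  nonempty := hne.image _
  nonneg := by
    rintro _ ⟨γ, -, rfl⟩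
    exact ⟨ENNReal.toReal_nonneg, ENNReal.toReal_nonneg⟩
  closed := by
    intro p q hp hq
    choose γ hγ hγp using hp
    have hq0 : 0 ≤ q.1 ∧ 0 ≤ q.2 := by
      constructor
      · refine ge_of_tendsto' ((continuous_fst.tendsto q).comp hq) fun n => ?_
        rw [Function.comp_apply, ← hγp]; exact ENNReal.toReal_nonneg
      · refine ge_of_tendsto' ((continuous_snd.tendsto q).comp hq) fun n => ?_
        rw [Function.comp_apply, ← hγp]; exact ENNReal.toReal_nonneg
    have h1 : Tendsto (fun n => kinetic (γ n)) atTop (𝓝 (ENNReal.ofReal q.1)) := by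
      refine (ENNReal.tendsto_ofReal ((continuous_fst.tendsto q).comp hq)).congr fun n => ?_
      rw [Function.comp_apply, ← hγp, energyPair,
        ENNReal.ofReal_toReal (kinetic_lt_top_iff.2 (hγ n).1).ne]
    have h2 : Tendsto (fun n => fisher E (γ n)) atTop (𝓝 (ENNReal.ofReal q.2)) := by
      refine (ENNReal.tendsto_ofReal ((continuous_snd.tendsto q).comp hq)).congr fun n => ?_
      rw [Function.comp_apply, ← hγp, energyPair, ENNReal.ofReal_toReal (hγ n).2.2.2.ne]
    obtain ⟨ω, hω, ha, hb⟩ := exists_joins_le_of_tendsto hσ (fun n => (hγ n).1)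
      (fun n => (hγ n).2.1) (fun n => (hγ n).2.2.1) h1 ENNReal.ofReal_lt_top h2
    refine ⟨_, ⟨ω, ⟨kinetic_lt_top_iff.1 (ha.trans_lt ENNReal.ofReal_lt_top), hω.2.1, hω.2.2,
      hb.trans_lt ENNReal.ofReal_lt_top⟩, rfl⟩, ?_, ?_⟩
    · exact ENNReal.toReal_le_of_le_ofReal hq0.1 ha
    · exact ENNReal.toReal_le_of_le_ofReal hq0.2 hb
  isGLB := by
    intro s hs
    constructor
    · rintro _ ⟨_, ⟨γ, hγ, rfl⟩, rfl⟩
      have hnn : 0 ≤ (energyPair E γ).1 + s * (energyPair E γ).2 :=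
        add_nonneg ENNReal.toReal_nonneg (mul_nonneg hs.le ENNReal.toReal_nonneg)
      refine ENNReal.toReal_le_of_le_ofReal hnn ?_
      rw [ofReal_energyPair hγ hs.le]
      exact costSq_le (hγ.1.joins hγ.2.1 hγ.2.2.1) s
    · intro c hc
      rw [← ENNReal.ofReal_le_iff_le_toReal (costSq_lt_top hne s).ne]
      refine le_iInf₂ fun γ hγ => ?_
      by_cases htop : kinetic γ + ENNReal.ofReal s * fisher E γ < ⊤
      · have hmem := mem_regularCurves_of_lt_top hγ hs htop
        rw [← ofReal_energyPair hmem hs.le]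
        exact ENNReal.ofReal_le_ofReal (hc ⟨_, ⟨γ, hmem, rfl⟩, rfl⟩)
      · rw [not_lt, top_le_iff] at htop
        rw [htop]; exact le_top

theorem mem_minimizers_iff (hne : (regularCurves E x y).Nonempty) {ε : ℝ} (hε : 0 < ε)
    {γ : ℝ → X} :
    γ ∈ minimizers E x y ε ↔ γ ∈ regularCurves E x y ∧
      (energyPair E γ).1 + ε ^ 2 * (energyPair E γ).2 = (costSq E x y (ε ^ 2)).toReal := by
  have hs : 0 < ε ^ 2 := by positivity
  constructor
  · rintro ⟨h1, h2, h3, h4⟩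
    have h5 : kinetic γ + ENNReal.ofReal (ε ^ 2) * fisher E γ = costSq E x y (ε ^ 2) := h4
    have hmem := mem_regularCurves_of_lt_top (E := E) (h1.joins h2 h3) hs
      (h5 ▸ costSq_lt_top hne (ε ^ 2))
    refine ⟨hmem, ?_⟩
    rw [← h5, ← ofReal_energyPair hmem hs.le, ENNReal.toReal_ofReal]
    exact add_nonneg ENNReal.toReal_nonneg (mul_nonneg hs.le ENNReal.toReal_nonneg)
  · rintro ⟨hmem, h⟩
    refine ⟨hmem.1, hmem.2.1, hmem.2.2.1, ?_⟩
    rw [cost_eq_costSq, ← ENNReal.ofReal_toReal (costSq_lt_top hne (ε ^ 2)).ne, ← h,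
      ofReal_energyPair hmem hs.le, action]

theorem exists_minimizer_of_mem_optimal (hne : (regularCurves E x y).Nonempty) {ε : ℝ}
    (hε : 0 < ε) {q : ℝ × ℝ} (hq : q ∈ optimal (energyPair E '' regularCurves E x y)
      (fun s => (costSq E x y s).toReal) (ε ^ 2)) :
    ∃ ω ∈ minimizers E x y ε, energyPair E ω = q := by
  obtain ⟨⟨ω, hω, rfl⟩, hF⟩ := hq
  exact ⟨ω, (mem_minimizers_iff hne hε).2 ⟨hω, hF⟩, rfl⟩

theorem energyPair_mem_optimal (hne : (regularCurves E x y).Nonempty) {ε : ℝ}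
    (hε : 0 < ε) {ω : ℝ → X} (hω : ω ∈ minimizers E x y ε) :
    energyPair E ω ∈ optimal (energyPair E '' regularCurves E x y)
      (fun s => (costSq E x y s).toReal) (ε ^ 2) := by
  obtain ⟨h1, h2⟩ := (mem_minimizers_iff hne hε).1 hω
  exact ⟨mem_image_of_mem _ h1, h2⟩

theorem regularCurves_nonempty_of_isSolvable {ε : ℝ} (hε : 0 < ε) (h : IsSolvable E x y ε) :
    (regularCurves E x y).Nonempty := by
  obtain ⟨γ, hγ, h1, h2⟩ := h
  exact ⟨γ, mem_regularCurves_of_lt_top hγ (s := ε ^ 2) (by positivity) (h1 ▸ h2)⟩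

/-- The cost is continuous at `s = 0`. -/
theorem continuousWithinAt_costSq_zero (hE : IsAdmissibleEnergy E)
    (hne : (regularCurves E x y).Nonempty) :
    ContinuousWithinAt (fun s => (costSq E x y s).toReal) (Ici 0) 0 := by
  have hmono : ∀ s, costSq E x y 0 ≤ costSq E x y s := fun s => by
    refine iInf₂_mono fun γ _ => ?_
    rw [ENNReal.ofReal_zero, zero_mul, add_zero]
    exact le_self_add
  have hxy : E x < ⊤ ∧ E y < ⊤ := by
    obtain ⟨ω, hω⟩ := hne
    have := lt_top_and_lt_top_of_fisher hE hω.1 hω.2.2.2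
    rwa [hω.2.1, hω.2.2.1] at this
  refine Metric.tendsto_nhds.2 fun η hη => ?_
  set c := (costSq E x y 0).toReal with hc
  have hlt : costSq E x y 0 < ENNReal.ofReal (c + η / 4) := by
    rw [← ENNReal.ofReal_toReal (costSq_lt_top hne 0).ne]
    exact (ENNReal.ofReal_lt_ofReal_iff
      (add_pos_of_nonneg_of_pos ENNReal.toReal_nonneg (by positivity))).2 (by linarith)
  obtain ⟨γ, hγ, hγlt⟩ : ∃ γ, Joins γ x y ∧ kinetic γ < ENNReal.ofReal (c + η / 4) := by
    obtain ⟨γ, hγ⟩ := iInf_lt_iff.1 hlt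
    obtain ⟨hj, hγ⟩ := iInf_lt_iff.1 hγ
    exact ⟨γ, hj, by simpa using hγ⟩
  have hAC : IsAC2 γ := kinetic_lt_top_iff.1 (hγlt.trans ENNReal.ofReal_lt_top)
  -- The near-minimiser `γ` of kinetic energy may have infinite Fisher information; `w` costs
  -- slightly more but makes the term `s * ℐ` vanish as `s → 0`.
  obtain ⟨w, hw, hwk, hwf⟩ := exists_joins_fisher_lt_top hE hAC (by rw [hγ.2.1]; exact hxy.1)
    (by rw [hγ.2.2]; exact hxy.2) (show 0 < η / 4 by positivity)
  rw [hγ.2.1, hγ.2.2] at hw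
  have hc0 : 0 ≤ c := ENNReal.toReal_nonneg
  have hwk' : kinetic w ≤ ENNReal.ofReal (c + η / 2) := by
    refine hwk.trans ((add_le_add_left hγlt.le _).trans (le_of_eq ?_))
    rw [← ENNReal.ofReal_add (by positivity) (by positivity)]
    congr 1
    ring
  set I := (fisher E w).toReal with hI
  have hI0 : 0 ≤ I := ENNReal.toReal_nonneg
  have hlim : Tendsto (fun s : ℝ => s * I) (𝓝[≥] 0) (𝓝 (0 * I)) :=
    (Continuous.tendsto (by fun_prop) _).mono_left nhdsWithin_le_nhds
  rw [zero_mul] at hlim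
  filter_upwards [hlim.eventually (gt_mem_nhds (show 0 < η / 4 by positivity)),
    self_mem_nhdsWithin] with s hs hs0
  have hs0' : 0 ≤ s := hs0
  have h1 : c ≤ (costSq E x y s).toReal :=
    ENNReal.toReal_mono (costSq_lt_top hne s).ne (hmono s)
  have h2 : (costSq E x y s).toReal ≤ c + η / 2 + s * I := by
    refine ENNReal.toReal_le_of_le_ofReal (by positivity) ?_
    rw [ENNReal.ofReal_add (by positivity) (by positivity), ENNReal.ofReal_mul hs0',
      hI, ENNReal.ofReal_toReal hwf.ne]
    exact (costSq_le hw s).trans (add_le_add_left hwk' _)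
  rw [Real.dist_eq, abs_lt]
  constructor <;> linarith

end Cost
end EntropicCost

/-! ### Assembly through the substitution `s = ε²`. -/

theorem proposition5p5 {X : Type*} [MetricSpace X] [CompleteSpace X]
    [TopologicalSpace.SeparableSpace X] (E : X → EReal)
    (hE : EntropicCost.IsAdmissibleEnergy E) (hσ : EntropicCost.HasWeakTopology E)
    (x y : X) (hxy : ∃ ε : ℝ, 0 < ε ∧ EntropicCost.IsSolvable E x y ε) :
    -- the cost is finite, so that it may be regarded as a real-valued function of `ε ≥ 0`
    (∀ ε : ℝ, 0 ≤ ε → EntropicCost.cost E x y ε < ⊤) ∧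
    -- local absolute continuity on `[0, ∞)`
    (∀ a b : ℝ, 0 ≤ a → a ≤ b →
      AbsolutelyContinuousOnInterval (fun ε => (EntropicCost.cost E x y ε).toReal) a b) ∧
    -- left derivative, the maximum being attained
    (∀ ε : ℝ, 0 < ε → ∃ ω ∈ EntropicCost.minimizers E x y ε,
      IsMaxOn (EntropicCost.fisher E) (EntropicCost.minimizers E x y ε) ω ∧
      EntropicCost.fisher E ω < ⊤ ∧
      HasDerivWithinAt (fun ε' => (EntropicCost.cost E x y ε').toReal)
        (2 * ε * (EntropicCost.fisher E ω).toReal) (Iic ε) ε) ∧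
    -- right derivative, the minimum being attained
    (∀ ε : ℝ, 0 < ε → ∃ ω ∈ EntropicCost.minimizers E x y ε,
      IsMinOn (EntropicCost.fisher E) (EntropicCost.minimizers E x y ε) ω ∧
      EntropicCost.fisher E ω < ⊤ ∧
      HasDerivWithinAt (fun ε' => (EntropicCost.cost E x y ε').toReal)
        (2 * ε * (EntropicCost.fisher E ω).toReal) (Ici ε) ε) ∧
    -- left continuity of the left derivative, right continuity of the right derivative
    (∀ ε : ℝ, 0 < ε → ContinuousWithinAt
      (fun s : ℝ => derivWithin (fun ε' => (EntropicCost.cost E x y ε').toReal) (Iic s) s)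
      (Iic ε) ε) ∧
    (∀ ε : ℝ, 0 < ε → ContinuousWithinAt
      (fun s : ℝ => derivWithin (fun ε' => (EntropicCost.cost E x y ε').toReal) (Ici s) s)
      (Ici ε) ε) := by
  obtain ⟨ε₀, hε₀, hsolv⟩ := hxy
  have hne := EntropicCost.regularCurves_nonempty_of_isSolvable hε₀ hsolv
  have henv := EntropicCost.isEnvelope_costSq hσ hne
  obtain ⟨m, hm⟩ := henv.exists_right_deriv
  obtain ⟨M, hM⟩ := henv.exists_left_deriv
  have hright : ∀ ε : ℝ, 0 < ε → HasDerivWithinAt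
      (fun ε' => (EntropicCost.cost E x y ε').toReal) (2 * ε * m (ε ^ 2)) (Ici ε) ε := fun ε hε =>
    EntropicCost.hasDerivWithinAt_comp_sq_Ici hε (hm (ε ^ 2) (by positivity)).2.1
  have hleft : ∀ ε : ℝ, 0 < ε → HasDerivWithinAt
      (fun ε' => (EntropicCost.cost E x y ε').toReal) (2 * ε * M (ε ^ 2)) (Iic ε) ε := fun ε hε =>
    EntropicCost.hasDerivWithinAt_comp_sq_Iic hε (hM (ε ^ 2) (by positivity)).2.1
  have hcont : ContinuousOn (fun ε' => (EntropicCost.cost E x y ε').toReal) (Ici 0) := by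
    intro ε hε
    rcases (mem_Ici.1 hε).eq_or_lt with rfl | hpos
    · have h0 := EntropicCost.continuousWithinAt_costSq_zero hE hne
      have h1 : ContinuousWithinAt (fun t : ℝ => t ^ 2) (Ici 0) 0 :=
        Continuous.continuousWithinAt (by fun_prop)
      refine ContinuousWithinAt.comp (t := Ici (0 : ℝ))
        (g := fun s => (EntropicCost.costSq E x y s).toReal) ?_ h1 fun t _ => sq_nonneg t
      simpa using h0
    · exact (continuousAt_iff_continuous_left_right.2
        ⟨(hleft ε hpos).continuousWithinAt, (hright ε hpos).continuousWithinAt⟩).continuousWithinAt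
  refine ⟨fun ε _ => EntropicCost.costSq_lt_top hne (ε ^ 2), ?_, ?_, ?_, ?_, ?_⟩
  · intro a b ha hab
    refine EntropicCost.absolutelyContinuousOnInterval_of_right_deriv_nonneg hab
      (hcont.mono fun t ht => ha.trans ht.1)
      (fun t ht => (hright t (ha.trans_lt ht.1)).mono Ioi_subset_Ici_self) fun t ht => ?_
    have ht0 : 0 < t := ha.trans_lt ht.1
    obtain ⟨q, hq, hqm, -⟩ := (hm (t ^ 2) (by positivity)).1
    rw [← hqm]
    have := (henv.nonneg q hq.1).2
    positivity
  · intro ε hε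
    obtain ⟨q, hq, hqM, hmax⟩ := (hM (ε ^ 2) (by positivity)).1
    obtain ⟨ω, hω, rfl⟩ := EntropicCost.exists_minimizer_of_mem_optimal hne hε hq
    have hfin := ((EntropicCost.mem_minimizers_iff hne hε).1 hω).1.2.2.2
    refine ⟨ω, hω, fun γ hγ => ?_, hfin, ?_⟩
    · have hγfin := ((EntropicCost.mem_minimizers_iff hne hε).1 hγ).1.2.2.2
      have h1 := hmax _ (EntropicCost.energyPair_mem_optimal hne hε hγ)
      rw [← hqM] at h1
      exact (ENNReal.toReal_le_toReal hγfin.ne hfin.ne).1 h1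
    · have h1 := hleft ε hε
      rwa [← hqM] at h1
  · intro ε hε
    obtain ⟨q, hq, hqm, hmin⟩ := (hm (ε ^ 2) (by positivity)).1
    obtain ⟨ω, hω, rfl⟩ := EntropicCost.exists_minimizer_of_mem_optimal hne hε hq
    have hfin := ((EntropicCost.mem_minimizers_iff hne hε).1 hω).1.2.2.2
    refine ⟨ω, hω, fun γ hγ => ?_, hfin, ?_⟩
    · have hγfin := ((EntropicCost.mem_minimizers_iff hne hε).1 hγ).1.2.2.2
      have h1 := hmin _ (EntropicCost.energyPair_mem_optimal hne hε hγ)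
      rw [← hqm] at h1
      exact (ENNReal.toReal_le_toReal hfin.ne hγfin.ne).1 h1
    · have h1 := hright ε hε
      rwa [← hqm] at h1
  · intro ε hε
    -- Only positive `t` are admitted: squaring is monotone there and the formula for the left
    -- derivative holds.
    have h1 : ContinuousWithinAt (fun t : ℝ => 2 * t * M (t ^ 2)) (Ioc 0 ε) ε := by
      refine ContinuousWithinAt.mul (Continuous.continuousWithinAt (by fun_prop)) ?_
      refine ContinuousWithinAt.comp (t := Iic (ε ^ 2)) (hM (ε ^ 2) (by positivity)).2.2
        (Continuous.continuousWithinAt (by fun_prop)) fun t ht => ?_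
      have := ht.1
      have := ht.2
      exact mem_Iic.2 (by gcongr)
    have h2 : ContinuousWithinAt (fun t : ℝ => derivWithin
        (fun ε' => (EntropicCost.cost E x y ε').toReal) (Iic t) t) (Ioc 0 ε) ε :=
      h1.congr (fun t ht => (hleft t ht.1).derivWithin (uniqueDiffWithinAt_Iic t))
        ((hleft ε hε).derivWithin (uniqueDiffWithinAt_Iic ε))
    exact h2.mono_of_mem_nhdsWithin (Ioc_mem_nhdsLE hε)
  · intro ε hε
    have h1 : ContinuousWithinAt (fun t : ℝ => 2 * t * m (t ^ 2)) (Ici ε) ε := by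
      refine ContinuousWithinAt.mul (Continuous.continuousWithinAt (by fun_prop)) ?_
      refine ContinuousWithinAt.comp (t := Ici (ε ^ 2)) (hm (ε ^ 2) (by positivity)).2.2
        (Continuous.continuousWithinAt (by fun_prop)) fun t ht => ?_
      have : ε ≤ t := ht
      exact mem_Ici.2 (by gcongr)
    exact h1.congr (fun t ht => (hright t (hε.trans_le ht)).derivWithin (uniqueDiffWithinAt_Ici t))
      ((hright ε hε).derivWithin (uniqueDiffWithinAt_Ici ε))
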